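/- Let $V_1$ be the complex vector space of binary linear forms with the natural action of $SL_2=SL_2(\mathbb{C})$, $(g\cdot \ell)(x)=\ell(g^{-1}x)$, and let $SL_2$ act on $\mathbb{C}^2$ by matrix multiplication. For $n\ge 1$ let $\mathcal{I}_n=\mathbb{C}[nV_1]^{SL_2}$ be the algebra of joint invariants and $\mathcal{C}_n=\mathbb{C}[nV_1\oplus\mathbb{C}^2]^{SL_2}$ the algebra of joint covariants of $n$ binary linear forms, where $nV_1=V_1\oplus\cdots\oplus V_1$ ($n$ summands). Both are graded by the degree in the coefficients of the $n$ forms (the degree of a covariant in the coordinates of $\mathbb{C}^2$, its order, is not counted). For a graded algebra $R=\bigoplus_{j\ge 0}R_j$ that is one of these, let $\mathcal{P}(R,z)=\sum_{j\ge 0}\dim_{\mathbb{C}}(R_j)\,z^j$ be its Poincaré series, let $r$ be the transcendence degree over $\mathbb{C}$ of the quotient field of $R$, and let $$\deg(R)=\lim_{z\to 1^-}(1-z)^r\,\mathcal{P}(R,z)$$ be the degree of $R$. Then for every $n\ge 1$ the graded pieces of $\mathcal{I}_n$ and $\mathcal{C}_n$ are finite-dimensional, both transcendence degrees are finite, both Poincaré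 series converge for $0<z<1$, the limits defining $\deg(\mathcal{I}_n)$ and $\deg(\mathcal{C}_n)$ exist, and, as $n\to\infty$, $$\deg(\mathcal{I}_n)\sim\frac{1}{2\sqrt{\pi n^3}}\qquad\text{and}\qquad \deg(\mathcal{C}_n)\sim\frac{1}{\sqrt{\pi n}}.$$ -/

import Mathlib

namespace LinearForms

open MvPolynomial Matrix Filter Topology

/-- The natural action of `SL₂(ℂ)` on the space `V₁` of binary linear forms, in coefficients.
The form `ℓ = c 0 * X + c 1 * Y` is represented by its coefficient vector `c`, and `g` sends `ℓ` to
`ℓ ∘ g⁻¹`, whose coefficient vector is the row vector `c` times `g⁻¹`. -/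
def formAct (g : SpecialLinearGroup (Fin 2) ℂ) (c : Fin 2 → ℂ) : Fin 2 → ℂ :=
  c ᵥ* ((g⁻¹ : SpecialLinearGroup (Fin 2) ℂ) : Matrix (Fin 2) (Fin 2) ℂ)

/-- The algebra `𝓘ₙ = ℂ[n V₁]^{SL₂}` of joint invariants of `n` binary linear forms. The variable
with index `(i, k)` is the `k`-th coefficient of the `i`-th form. -/
def jointInvariants (n : ℕ) : Subalgebra ℂ (MvPolynomial (Fin n × Fin 2) ℂ) where
  carrier := {f | ∀ (g : SpecialLinearGroup (Fin 2) ℂ) (c : Fin n → Fin 2 → ℂ),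
    eval (fun p => formAct g (c p.1) p.2) f = eval (fun p => c p.1 p.2) f}
  mul_mem' := fun ha hb g c => by rw [map_mul, map_mul, ha g c, hb g c]
  add_mem' := fun ha hb g c => by rw [map_add, map_add, ha g c, hb g c]
  algebraMap_mem' := fun r g c => by simp [algebraMap_eq]

/-- The algebra `𝓒ₙ = ℂ[n V₁ ⊕ ℂ²]^{SL₂}` of joint covariants of `n` binary linear forms, where
`SL₂(ℂ)` acts on `ℂ²` by `x ↦ g x`. The variables `Sum.inl (i, k)` are the coefficients of the
forms, the variables `Sum.inr k` are the coordinates on `ℂ²`. -/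
def jointCovariants (n : ℕ) : Subalgebra ℂ (MvPolynomial ((Fin n × Fin 2) ⊕ Fin 2) ℂ) where
  carrier := {f | ∀ (g : SpecialLinearGroup (Fin 2) ℂ) (c : Fin n → Fin 2 → ℂ) (x : Fin 2 → ℂ),
    eval (Sum.elim (fun p => formAct g (c p.1) p.2)
      ((g : Matrix (Fin 2) (Fin 2) ℂ) *ᵥ x)) f =
    eval (Sum.elim (fun p => c p.1 p.2) x) f}
  mul_mem' := fun ha hb g c x => by rw [map_mul, map_mul, ha g c x, hb g c x]
  add_mem' := fun ha hb g c x => by rw [map_add, map_add, ha g c x, hb g c x]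
  algebraMap_mem' := fun r g c x => by simp [algebraMap_eq]

/-- `(𝓘ₙ)_j`: the joint invariants that are homogeneous of degree `j`. -/
noncomputable def invariantsGrading (n : ℕ) (j : ℕ) : Submodule ℂ (jointInvariants n) :=
  (homogeneousSubmodule (Fin n × Fin 2) ℂ j).comap (jointInvariants n).val.toLinearMap

/-- `(𝓒ₙ)_j`: the joint covariants of degree `j`. As usual for covariants, the degree is the one in
the coefficients of the forms; the degree in the coordinates of `ℂ²` (called the order of the
covariant) is not counted. -/
noncomputable def covariantsGrading (n : ℕ) (j : ℕ) : Submodule ℂ (jointCovariants n) :=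
  (weightedHomogeneousSubmodule ℂ
    (Sum.elim (fun _ => 1) (fun _ => 0) : (Fin n × Fin 2) ⊕ Fin 2 → ℕ) j).comap
      (jointCovariants n).val.toLinearMap

/-- The Poincaré series `∑ (dim R_j) z^j` of a graded complex algebra. -/
noncomputable def poincareSeries {R : Type*} [CommRing R] [Algebra ℂ R]
    (𝒜 : ℕ → Submodule ℂ R) : PowerSeries ℝ :=
  PowerSeries.mk fun j => (Module.finrank ℂ (𝒜 j) : ℝ)

/-- `d` is the degree of the graded complex domain `R = ⨁ 𝒜 j`: the graded pieces are
finite-dimensional, the quotient field of `R` has finite transcendence degree `r` over `ℂ`, the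
Poincaré series converges on `(0, 1)`, and `(1 - z) ^ r * P(R, z) → d` as `z → 1`. -/
def HasDegree {R : Type*} [CommRing R] [IsDomain R] [Algebra ℂ R]
    (𝒜 : ℕ → Submodule ℂ R) (d : ℝ) : Prop :=
  (∀ j, Module.Finite ℂ (𝒜 j)) ∧
  ∃ r : ℕ, Algebra.trdeg ℂ (FractionRing R) = r ∧
    (∀ z ∈ Set.Ioo (0 : ℝ) 1, Summable fun j => (poincareSeries 𝒜).coeff j * z ^ j) ∧
    Tendsto (fun z : ℝ => (1 - z) ^ r * ∑' j, (poincareSeries 𝒜).coeff j * z ^ j)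
      (𝓝[<] 1) (𝓝 d)

end LinearForms

/-!
In each multidegree the invariants are the vectors of weight `0` killed by the raising operator, and
`sl₂`-theory counts them as the number of monomials of weight `0` minus the number of those of
weight `2`. For `n` forms the result is zero in odd degrees and, in degree `2 * (m + 1)`, a
difference of products of multiset coefficients which is asymptotic to
`catalan (n - 2) * (m + 2 * n - 4).choose (2 * n - 4)`.

The action of `SL₂` on `ℂ²` is isomorphic to that on linear forms, so a covariant of `n` forms is an
invariant of `n + 1` forms for which the degree in the last form is not counted. Summing the weight
count over that degree telescopes, and leaves the product of the numbers of monomials of degrees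
`⌊j / 2⌋` and `⌈j / 2⌉` in `n` variables.

Two linearly independent forms can be moved to a standard position by `SL₂`, up to the value of
their bracket. The values of an invariant on this slice determine it, so the transcendence degree
is `2 * n - 3`, and `2 * n - 1` for the covariants. An Abelian theorem comparing the Poincaré series
with `∑ m, (m + k).choose k * z ^ m = 1 / (1 - z) ^ (k + 1)` now gives
`deg(𝓘ₙ) = catalan (n - 2) / 2 ^ (2 * n - 3)` for `n ≥ 2` and
`deg(𝓒ₙ) = centralBinom (n - 1) / 4 ^ (n - 1)`, and Stirling's formula finishes the proof.
-/

namespace LinearForms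

universe u

open MvPolynomial Matrix Filter Topology Asymptotics LieModule

section Sl2Triple

variable {K L M : Type*} [LieRing L] [AddCommGroup M] [LieRingModule L M] {h e f : L}

section CommRing

variable [CommRing K] [LieAlgebra K L] [Module K M] [LieModule K L M]

theorem lie_h_lie_e (t : IsSl2Triple h e f) {v : M} {μ : K} (hv : ⁅h, v⁆ = μ • v) :
    ⁅h, ⁅e, v⁆⁆ = (μ + 2) • ⁅e, v⁆ := by
  rw [leibniz_lie, t.lie_h_e_smul K, hv, smul_lie, lie_smul, ← add_smul, add_comm]

theorem lie_h_lie_f (t : IsSl2Triple h e f) {v : M} {μ : K} (hv : ⁅h, v⁆ = μ • v) :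
    ⁅h, ⁅f, v⁆⁆ = (μ - 2) • ⁅f, v⁆ := by
  rw [leibniz_lie, t.lie_lie_smul_f K, hv, neg_lie, smul_lie, lie_smul, sub_smul, neg_add_eq_sub]

theorem lie_h_toEnd_e_pow (t : IsSl2Triple h e f) {v : M} {μ : K} (hv : ⁅h, v⁆ = μ • v) (k : ℕ) :
    ⁅h, (toEnd K L M e ^ k) v⁆ = (μ + 2 * k) • (toEnd K L M e ^ k) v := by
  induction k with
  | zero => simp [hv]
  | succ k ih =>
    rw [pow_succ', Module.End.mul_apply, toEnd_apply_apply, lie_h_lie_e t ih]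
    push_cast
    ring_nf

theorem toEnd_e_pow_succ_lie_f (t : IsSl2Triple h e f) {v : M} {μ : K} (hv : ⁅h, v⁆ = μ • v)
    (k : ℕ) : (toEnd K L M e ^ (k + 1)) ⁅f, v⁆ =
      ⁅f, (toEnd K L M e ^ (k + 1)) v⁆ + ((k + 1) * (μ + k)) • (toEnd K L M e ^ k) v := by
  have lie_e_lie_f (w : M) : ⁅e, ⁅f, w⁆⁆ = ⁅f, ⁅e, w⁆⁆ + ⁅h, w⁆ := by
    rw [leibniz_lie, t.lie_e_f, add_comm]
  induction k with
  | zero => simp [lie_e_lie_f, hv]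
  | succ k ih =>
    rw [pow_succ', Module.End.mul_apply, ih, toEnd_apply_apply, lie_add, lie_smul, lie_e_lie_f,
      lie_h_toEnd_e_pow t hv, ← toEnd_apply_apply K L M e, ← Module.End.mul_apply, ← pow_succ',
      ← toEnd_apply_apply K L M e, ← Module.End.mul_apply, ← pow_succ', add_assoc, ← add_smul]
    push_cast
    ring_nf

end CommRing

variable [Field K] [CharZero K] [LieAlgebra K L] [Module K M] [LieModule K L M]

theorem exists_lie_e_eq (t : IsSl2Triple h e f) {p : Submodule K M}
    (he : ∀ v ∈ p, ⁅e, v⁆ ∈ p) (hf : ∀ v ∈ p, ⁅f, v⁆ ∈ p) {μ : K} (hμ : ∀ k : ℕ, μ + k ≠ 0)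
    {v : M} (hvp : v ∈ p) (hv : ⁅h, v⁆ = μ • v) {k : ℕ} (hk : (toEnd K L M e ^ k) v = 0) :
    ∃ u ∈ p, ⁅h, u⁆ = (μ - 2) • u ∧ ⁅e, u⁆ = v := by
  induction k generalizing v with
  | zero => exact ⟨0, p.zero_mem, by simp, by simpa using hk.symm⟩
  | succ k ih =>
    -- `e ^ k` annihilates `e f v - c v`, so this vector lies in the image of `e`.
    set c : K := (k + 1) * (μ + k)
    have hc : c ≠ 0 := mul_ne_zero (by exact_mod_cast k.succ_ne_zero) (hμ k)
    have hfv : ⁅h, ⁅f, v⁆⁆ = (μ - 2) • ⁅f, v⁆ := lie_h_lie_f t hv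
    obtain ⟨u, hup, hu, huv⟩ := ih (v := ⁅e, ⁅f, v⁆⁆ - c • v)
      (p.sub_mem (he _ (hf _ hvp)) (p.smul_mem _ hvp))
      (by rw [lie_sub, lie_smul, lie_h_lie_e t hfv, hv]; module)
      (by rw [map_sub, map_smul, ← toEnd_apply_apply K L M e, ← Module.End.mul_apply, ← pow_succ,
        toEnd_e_pow_succ_lie_f t hv, hk, lie_zero, zero_add, sub_self])
    refine ⟨c⁻¹ • (⁅f, v⁆ - u), p.smul_mem _ (p.sub_mem (hf _ hvp) hup), ?_, ?_⟩
    · rw [lie_smul, lie_sub, hfv, hu]; module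
    · rw [lie_smul, lie_sub, huv, sub_sub_cancel, inv_smul_smul₀ hc]

theorem eq_zero_of_lie_f_eq_zero (t : IsSl2Triple h e f) {μ : K} (hμ : ∀ k : ℕ, μ + k ≠ 0)
    {v : M} (hv : ⁅h, v⁆ = μ • v) (hfv : ⁅f, v⁆ = 0) {k : ℕ}
    (hk : (toEnd K L M e ^ k) v = 0) : v = 0 := by
  induction k with
  | zero => simpa using hk
  | succ k ih =>
    have hek := toEnd_e_pow_succ_lie_f t hv k
    rw [hfv, hk, map_zero, lie_zero, zero_add, eq_comm, smul_eq_zero] at hek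
    exact ih (hek.resolve_left (mul_ne_zero (by exact_mod_cast k.succ_ne_zero) (hμ k)))

theorem lie_f_eq_zero_of_lie_e_eq_zero (t : IsSl2Triple h e f)
    (hnil : ∀ v : M, ∃ k, (toEnd K L M f ^ k) v = 0) {v : M} (hv : ⁅h, v⁆ = 0)
    (hev : ⁅e, v⁆ = 0) : ⁅f, v⁆ = 0 := by
  obtain ⟨k, hk⟩ := hnil ⁅f, v⁆
  have hfv : ⁅-h, ⁅f, v⁆⁆ = (2 : K) • ⁅f, v⁆ := by
    rw [neg_lie, lie_h_lie_f t (μ := (0 : K)) (by rw [hv, zero_smul]), zero_sub, neg_smul, neg_neg]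
  refine eq_zero_of_lie_f_eq_zero t.symm (fun k => by norm_cast; omega) hfv ?_ hk
  rw [leibniz_lie, t.lie_e_f, hv, hev, lie_zero, add_zero]

theorem finrank_ker_lie_e_add_finrank_eigenspace_two (t : IsSl2Triple h e f) {p : Submodule K M}
    (he : ∀ v ∈ p, ⁅e, v⁆ ∈ p) (hf : ∀ v ∈ p, ⁅f, v⁆ ∈ p)
    (hnil : ∀ v : M, ∃ k, (toEnd K L M e ^ k) v = 0)
    [Module.Finite K ↥(p ⊓ (toEnd K L M h).eigenspace 0)] :
    Module.finrank K ↥(p ⊓ (toEnd K L M h).eigenspace 0 ⊓ (toEnd K L M e).ker) +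
      Module.finrank K ↥(p ⊓ (toEnd K L M h).eigenspace 2) =
      Module.finrank K ↥(p ⊓ (toEnd K L M h).eigenspace 0) := by
  have mem_weight {μ : K} {v : M} :
      v ∈ p ⊓ (toEnd K L M h).eigenspace μ ↔ v ∈ p ∧ ⁅h, v⁆ = μ • v := by
    rw [Submodule.mem_inf, Module.End.mem_eigenspace_iff, toEnd_apply_apply]
  have hmaps : ∀ v ∈ p ⊓ (toEnd K L M h).eigenspace 0,
      toEnd K L M e v ∈ p ⊓ (toEnd K L M h).eigenspace 2 := fun v hv => by
    rw [mem_weight] at hv ⊢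
    exact ⟨he v hv.1, by simpa using lie_h_lie_e t hv.2⟩
  let T := (toEnd K L M e).restrict hmaps
  have hsurj : Function.Surjective T := by
    rintro ⟨v, hv⟩
    rw [mem_weight] at hv
    obtain ⟨k, hk⟩ := hnil v
    obtain ⟨u, hup, hu, huv⟩ :=
      exists_lie_e_eq t he hf (fun k => by norm_cast; omega) hv.1 hv.2 hk
    exact ⟨⟨u, mem_weight.2 ⟨hup, by simpa using hu⟩⟩, Subtype.ext huv⟩
  have hker : p ⊓ (toEnd K L M h).eigenspace 0 ⊓ (toEnd K L M e).ker =
      T.ker.map (p ⊓ (toEnd K L M h).eigenspace 0).subtype := by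
    rw [LinearMap.ker_restrict, Submodule.map_comap_subtype]
  rw [hker, Submodule.finrank_map_subtype_eq, add_comm, ← T.finrank_range_add_finrank_ker,
    LinearMap.range_eq_top.2 hsurj, finrank_top]

end Sl2Triple

/-- The `SL₂(K)`-invariant polynomials in the coefficients of a family of binary linear forms
indexed by `σ`. The group acts on coefficient vectors by `c ↦ c ᵥ* g`, which has the same invariants
as `c ↦ c ᵥ* g⁻¹`. -/
def vectorInvariants (K σ : Type*) [CommRing K] : Subalgebra K (MvPolynomial (σ × Fin 2) K) where
  carrier := {f | ∀ (g : SpecialLinearGroup (Fin 2) K) (c : σ → Fin 2 → K),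
    eval (fun p => (c p.1 ᵥ* (g : Matrix (Fin 2) (Fin 2) K)) p.2) f = eval (fun p => c p.1 p.2) f}
  mul_mem' := fun ha hb g c => by rw [map_mul, map_mul, ha g c, hb g c]
  add_mem' := fun ha hb g c => by rw [map_add, map_add, ha g c, hb g c]
  algebraMap_mem' := fun r g c => by simp [algebraMap_eq]

section Polarization

variable {K σ : Type*} [CommRing K] {a b : Fin 2}

/-- The polarization operator `∑ i, X (i, a) * ∂ / ∂ X (i, b)`, the infinitesimal generator of the
shears `c b ↦ c b + s * c a`. -/
noncomputable def polarization (K σ : Type*) [CommRing K] (a b : Fin 2) :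
    Derivation K (MvPolynomial (σ × Fin 2) K) (MvPolynomial (σ × Fin 2) K) :=
  mkDerivation K fun p => if p.2 = b then X (p.1, a) else 0

/-- A polynomial evaluated at the sheared point `c b ↦ c b + s * c a`, as a polynomial in `s`. -/
noncomputable def shear (a b : Fin 2) (c : σ → Fin 2 → K) :
    MvPolynomial (σ × Fin 2) K →ₐ[K] Polynomial K :=
  aeval fun p => Polynomial.C (c p.1 p.2) +
    if p.2 = b then Polynomial.X * Polynomial.C (c p.1 a) else 0

theorem derivative_shear (hab : a ≠ b) (c : σ → Fin 2 → K) (f : MvPolynomial (σ × Fin 2) K) :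
    Polynomial.derivative (shear a b c f) = shear a b c (polarization K σ a b f) := by
  induction f using MvPolynomial.induction_on with
  | C r => simp [shear, polarization]
  | add p q hp hq => simp only [map_add, hp, hq]
  | mul_X p i hp =>
    have hX : Polynomial.derivative (shear a b c (X i)) =
        shear a b c (polarization K σ a b (X i)) := by
      simp only [shear, polarization, mkDerivation_X, aeval_X]
      split_ifs <;> simp [hab]
    rw [map_mul, Polynomial.derivative_mul, hp, hX, Derivation.leibniz, smul_eq_mul, smul_eq_mul,
      map_add, map_mul, map_mul]
    ring

theorem iterate_derivative_shear (hab : a ≠ b) (c : σ → Fin 2 → K)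
    (f : MvPolynomial (σ × Fin 2) K) (k : ℕ) :
    Polynomial.derivative^[k] (shear a b c f) =
      shear a b c ((toEnd K _ _ (polarization K σ a b) ^ k) f) := by
  induction k with
  | zero => rfl
  | succ k ih =>
    rw [Function.iterate_succ_apply', ih, derivative_shear hab, pow_succ']
    rfl

theorem natDegree_shear_le (c : σ → Fin 2 → K) (f : MvPolynomial (σ × Fin 2) K) :
    (shear a b c f).natDegree ≤ f.totalDegree := by
  have hX (p : σ × Fin 2) : (Polynomial.C (c p.1 p.2) +
      if p.2 = b then Polynomial.X * Polynomial.C (c p.1 a) else 0).natDegree ≤ 1 := by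
    split_ifs <;> compute_degree!
  exact (aeval_natDegree_le f le_rfl _ hX).trans_eq (mul_one _)

theorem vecMul_transvection_apply (hab : a ≠ b) (c : Fin 2 → K) (s : K) (k : Fin 2) :
    (c ᵥ* (SpecialLinearGroup.transvection hab s : Matrix (Fin 2) (Fin 2) K)) k =
      c k + if k = b then s * c a else 0 := by
  rw [SpecialLinearGroup.transvection_coe, Matrix.vecMul_add, Matrix.vecMul_one, Pi.add_apply]
  congr 1
  simp [Matrix.vecMul, dotProduct, Matrix.single_apply, ite_and, eq_comm, mul_comm]

theorem eval_shear (hab : a ≠ b) (c : σ → Fin 2 → K) (f : MvPolynomial (σ × Fin 2) K) (s : K) :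
    Polynomial.eval s (shear a b c f) =
      eval (fun p => (c p.1 ᵥ* (SpecialLinearGroup.transvection hab s :
        Matrix (Fin 2) (Fin 2) K)) p.2) f := by
  have h : (Polynomial.aeval s).comp (shear a b c) =
      aeval fun p => (c p.1 ᵥ* (SpecialLinearGroup.transvection hab s :
        Matrix (Fin 2) (Fin 2) K)) p.2 := by
    ext p
    rw [aeval_X, vecMul_transvection_apply, AlgHom.comp_apply, shear, aeval_X]
    split_ifs <;> simp [mul_comm s]
  simpa [Polynomial.coe_aeval_eq_eval] using DFunLike.congr_fun h f

theorem eval_zero_shear (c : σ → Fin 2 → K) (f : MvPolynomial (σ × Fin 2) K) :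
    Polynomial.eval 0 (shear a b c f) = eval (fun p => c p.1 p.2) f := by
  have h : (Polynomial.aeval 0).comp (shear a b c) = aeval fun p => c p.1 p.2 := by
    ext p
    rw [aeval_X, AlgHom.comp_apply, shear, aeval_X]
    split_ifs <;> simp
  simpa [Polynomial.coe_aeval_eq_eval] using DFunLike.congr_fun h f

theorem eq_zero_of_shear_eq_zero [IsDomain K] [Infinite K] {f : MvPolynomial (σ × Fin 2) K}
    (h : ∀ c, shear a b c f = 0) : f = 0 :=
  MvPolynomial.funext fun x => by
    rw [map_zero, ← Polynomial.eval_zero (x := 0), ← h fun i k => x (i, k), eval_zero_shear]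

theorem exists_toEnd_polarization_pow_eq_zero [IsDomain K] [Infinite K] (hab : a ≠ b)
    (f : MvPolynomial (σ × Fin 2) K) :
    ∃ k, (toEnd K _ _ (polarization K σ a b) ^ k) f = 0 := by
  refine ⟨f.totalDegree + 1, eq_zero_of_shear_eq_zero (a := a) (b := b) fun c => ?_⟩
  rw [← iterate_derivative_shear hab]
  exact Polynomial.iterate_derivative_eq_zero
    ((natDegree_shear_le c f).trans_lt (Nat.lt_succ_self _))

theorem polarization_eq_zero_iff [IsDomain K] [CharZero K] (hab : a ≠ b)
    {f : MvPolynomial (σ × Fin 2) K} :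
    polarization K σ a b f = 0 ↔ ∀ (s : K) (c : σ → Fin 2 → K),
      eval (fun p => (c p.1 ᵥ* (SpecialLinearGroup.transvection hab s :
        Matrix (Fin 2) (Fin 2) K)) p.2) f = eval (fun p => c p.1 p.2) f := by
  simp only [← eval_shear hab]
  constructor
  · intro h s c
    have hconst : Polynomial.derivative (shear a b c f) = 0 := by
      rw [derivative_shear hab, h, map_zero]
    rw [← eval_zero_shear (a := a) (b := b),
      Polynomial.eq_C_of_derivative_eq_zero hconst, Polynomial.eval_C, Polynomial.eval_C]
  · intro h
    refine eq_zero_of_shear_eq_zero (a := a) (b := b) fun c => ?_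
    have hconst : shear a b c f = Polynomial.C (eval (fun p => c p.1 p.2) f) :=
      Polynomial.funext fun s => by rw [h, Polynomial.eval_C]
    rw [← derivative_shear hab, hconst, Polynomial.derivative_C]

theorem mem_vectorInvariants_iff_polarization {K : Type*} [Field K] [CharZero K]
    {f : MvPolynomial (σ × Fin 2) K} :
    f ∈ vectorInvariants K σ ↔ polarization K σ 0 1 f = 0 ∧ polarization K σ 1 0 f = 0 := by
  rw [polarization_eq_zero_iff zero_ne_one, polarization_eq_zero_iff one_ne_zero]
  refine ⟨fun h => ⟨fun s => h _, fun s => h _⟩, fun h g => ?_⟩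
  induction g using Matrix.SL2.transvection_induction with
  | htransvec i j hij s =>
    intro c
    fin_cases i <;> fin_cases j
    · exact absurd rfl hij
    · exact h.1 s c
    · exact h.2 s c
    · exact absurd rfl hij
  | hmul A B hA hB =>
    intro c
    have hBA := hB fun i => c i ᵥ* (A : Matrix (Fin 2) (Fin 2) K)
    simp only [Matrix.vecMul_vecMul] at hBA
    exact hBA.trans (hA c)

end Polarization

section Weight

variable {K σ : Type*} [CommRing K]

/-- The Cartan derivation, whose eigenvectors are the polynomials of a given torus weight. -/
noncomputable def cartan (K σ : Type*) [CommRing K] :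
    Derivation K (MvPolynomial (σ × Fin 2) K) (MvPolynomial (σ × Fin 2) K) :=
  mkDerivation K fun p => if p.2 = 0 then X p else -X p

theorem isSl2Triple_cartan [Nontrivial K] [Nonempty σ] :
    IsSl2Triple (cartan K σ) (polarization K σ 0 1) (polarization K σ 1 0) where
  h_ne_zero h := by
    obtain ⟨i⟩ := ‹Nonempty σ›
    have := congrArg (fun D => D (X (i, 0))) h
    simp [cartan] at this
  lie_e_f := derivation_ext fun ⟨i, k⟩ => by
    fin_cases k <;> simp [Derivation.commutator_apply, polarization, cartan]
  lie_h_e_nsmul := derivation_ext fun ⟨i, k⟩ => by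
    fin_cases k <;> simp [Derivation.commutator_apply, polarization, cartan, two_smul]
  lie_h_f_nsmul := derivation_ext fun ⟨i, k⟩ => by
    fin_cases k <;> simp [Derivation.commutator_apply, polarization, cartan, two_smul]
    abel

theorem mem_vectorInvariants_iff_raising {K : Type*} [Field K] [CharZero K] [Nonempty σ]
    {f : MvPolynomial (σ × Fin 2) K} :
    f ∈ vectorInvariants K σ ↔ cartan K σ f = 0 ∧ polarization K σ 0 1 f = 0 := by
  have t := isSl2Triple_cartan (K := K) (σ := σ)
  rw [mem_vectorInvariants_iff_polarization]
  constructor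
  · rintro ⟨he, hf⟩
    refine ⟨?_, he⟩
    rw [← t.lie_e_f, Derivation.commutator_apply, he, hf, map_zero, map_zero, sub_zero]
  · rintro ⟨hh, he⟩
    exact ⟨he, lie_f_eq_zero_of_lie_e_eq_zero (K := K) t
      (exists_toEnd_polarization_pow_eq_zero one_ne_zero) hh he⟩

end Weight

theorem finite_restrictSupport {σ : Type*} (R : Type*) [CommSemiring R] {s : Set (σ →₀ ℕ)}
    (hs : s.Finite) : Module.Finite R (restrictSupport R s) :=
  have := hs.to_subtype
  .of_basis (basisRestrictSupport R s)

theorem finrank_restrictSupport {σ : Type*} (R : Type*) [CommRing R] [Nontrivial R]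
    (s : Set (σ →₀ ℕ)) : Module.finrank R (restrictSupport R s) = s.ncard := by
  rw [Module.finrank_eq_nat_card_basis (basisRestrictSupport R s), Nat.card_coe_set_eq]

section Multidegree

variable {K σ : Type*} [CommRing K]

/-- The multidegree of a monomial: its degree in the coefficients of each form. -/
def multideg (m : σ × Fin 2 →₀ ℕ) (i : σ) : ℕ := m (i, 0) + m (i, 1)

theorem polarization_monomial_mem {a b : Fin 2} (hab : a ≠ b) (m : σ × Fin 2 →₀ ℕ) (r : K) :
    polarization K σ a b (monomial m r) ∈ restrictSupport K {m' | multideg m' = multideg m} := by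
  rw [polarization, mkDerivation_monomial]
  refine Submodule.smul_mem _ _ (Submodule.sum_mem _ fun ⟨i, k⟩ hik => ?_)
  have hm : m (i, k) ≠ 0 := Finsupp.mem_support_iff.1 hik
  dsimp only
  split_ifs with hk
  · subst hk
    rw [X, smul_eq_mul, monomial_mul, monomial_mem_restrictSupport]
    left
    funext j
    by_cases hj : j = i
    · subst hj
      fin_cases a <;> fin_cases k <;> simp [multideg] at hab hm ⊢ <;> omega
    · simp [multideg, Ne.symm hj]
  · simp

theorem polarization_mem_restrictSupport {a b : Fin 2} (hab : a ≠ b) (Δ : Set (σ → ℕ))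
    {f : MvPolynomial (σ × Fin 2) K} (hf : f ∈ restrictSupport K (multideg ⁻¹' Δ)) :
    polarization K σ a b f ∈ restrictSupport K (multideg ⁻¹' Δ) := by
  rw [f.as_sum, map_sum]
  refine Submodule.sum_mem _ fun m hm => restrictSupport_mono K (fun m' hm' => ?_)
    (polarization_monomial_mem hab m _)
  rw [Set.mem_preimage, show multideg m' = multideg m from hm']
  exact hf hm

variable [Fintype σ]

/-- The degree of a monomial in the `k`-th coefficients of the forms. -/
def coeffDeg (k : Fin 2) (m : σ × Fin 2 →₀ ℕ) : ℕ := ∑ i, m (i, k)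

/-- The weight of a monomial under the diagonal torus of `SL₂`. -/
def torusWeight (m : σ × Fin 2 →₀ ℕ) : ℤ := coeffDeg 0 m - coeffDeg 1 m

theorem sum_multideg (m : σ × Fin 2 →₀ ℕ) :
    ∑ i, multideg m i = coeffDeg 0 m + coeffDeg 1 m := by
  simp only [multideg, coeffDeg, Finset.sum_add_distrib]

theorem cartan_monomial (m : σ × Fin 2 →₀ ℕ) (r : K) :
    cartan K σ (monomial m r) = (torusWeight m : K) • monomial m r := by
  have hterm (p : σ × Fin 2) : monomial (m - Finsupp.single p 1) ((m p : ℕ) : K) •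
      (if p.2 = 0 then X p else -X p : MvPolynomial (σ × Fin 2) K) =
        ((if p.2 = 0 then 1 else -1 : K) * m p) • monomial m 1 := by
    have hX : monomial (m - Finsupp.single p 1) ((m p : ℕ) : K) * X p =
        (m p : K) • monomial m 1 := by
      rw [X, monomial_mul, smul_monomial]
      by_cases hp : m p = 0
      · simp [hp]
      · rw [tsub_add_cancel_of_le (Finsupp.single_le_iff.2 (Nat.one_le_iff_ne_zero.2 hp))]
        simp
    split_ifs
    · rw [smul_eq_mul, hX, one_mul]
    · rw [smul_eq_mul, mul_neg, hX, neg_one_mul, neg_smul]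
  rw [cartan, mkDerivation_monomial, Finsupp.sum_fintype _ _ (by simp),
    Finset.sum_congr rfl fun p _ => hterm p, ← Finset.sum_smul, smul_smul, smul_monomial,
    smul_monomial, Fintype.sum_prod_type]
  simp [Fin.sum_univ_two, torusWeight, coeffDeg, sub_eq_add_neg, Finset.sum_add_distrib, mul_comm]

theorem coeff_cartan (m : σ × Fin 2 →₀ ℕ) (f : MvPolynomial (σ × Fin 2) K) :
    coeff m (cartan K σ f) = torusWeight m * coeff m f := by
  classical
  conv_lhs => rw [f.as_sum, map_sum, coeff_sum]
  simp only [cartan_monomial, coeff_smul, coeff_monomial, smul_eq_mul, mul_ite, mul_zero,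
    Finset.sum_ite_eq', mem_support_iff]
  split_ifs with h
  · rfl
  · rw [not_not.1 h, mul_zero]

theorem cartan_eq_smul_iff [IsDomain K] [CharZero K] {f : MvPolynomial (σ × Fin 2) K} {μ : ℤ} :
    cartan K σ f = (μ : K) • f ↔ f ∈ restrictSupport K {m | torusWeight m = μ} := by
  rw [mem_restrictSupport_iff, MvPolynomial.ext_iff]
  refine forall_congr' fun m => ?_
  rw [coeff_cartan, coeff_smul, smul_eq_mul, mul_eq_mul_right_iff, Finset.mem_coe, mem_support_iff,
    Set.mem_ofPred_eq, Int.cast_inj]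
  tauto

theorem restrictSupport_inf_eigenspace_cartan [IsDomain K] [CharZero K] (Δ : Set (σ → ℕ)) (μ : ℤ) :
    restrictSupport K (multideg ⁻¹' Δ) ⊓ (toEnd K _ _ (cartan K σ)).eigenspace μ =
      restrictSupport K {m | multideg m ∈ Δ ∧ torusWeight m = μ} := by
  ext f
  rw [Submodule.mem_inf, Module.End.mem_eigenspace_iff, toEnd_apply_apply,
    Derivation.bracket_eq_fun, cartan_eq_smul_iff]
  exact Set.subset_inter_iff.symm

end Multidegree

section MultidegInvariants

variable {σ : Type*} (K : Type*)

/-- The invariants all of whose monomials have multidegree in a given set. -/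
noncomputable def multidegInvariants [CommRing K] (Δ : Set (σ → ℕ)) :
    Submodule K (MvPolynomial (σ × Fin 2) K) :=
  (vectorInvariants K σ).toSubmodule ⊓ restrictSupport K (multideg ⁻¹' Δ)

variable {K} in
theorem multidegInvariants_mono [CommRing K] {Δ Δ' : Set (σ → ℕ)} (h : Δ ⊆ Δ') :
    multidegInvariants K Δ ≤ multidegInvariants K Δ' :=
  inf_le_inf_left _ (restrictSupport_mono K (Set.preimage_mono h))

variable [Field K]

theorem finite_multidegInvariants {Δ : Set (σ → ℕ)}
    (hΔ : (multideg ⁻¹' Δ : Set (σ × Fin 2 →₀ ℕ)).Finite) :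
    Module.Finite K (multidegInvariants K Δ) :=
  have := finite_restrictSupport K hΔ
  Submodule.finiteDimensional_inf_right _ _

theorem finrank_multidegInvariants_add_ncard [CharZero K] [Fintype σ] [Nonempty σ]
    {Δ : Set (σ → ℕ)} (hΔ : (multideg ⁻¹' Δ : Set (σ × Fin 2 →₀ ℕ)).Finite) :
    Module.finrank K (multidegInvariants K Δ) +
      {m : σ × Fin 2 →₀ ℕ | multideg m ∈ Δ ∧ torusWeight m = 2}.ncard =
      {m : σ × Fin 2 →₀ ℕ | multideg m ∈ Δ ∧ torusWeight m = 0}.ncard := by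
  have eigenspace_eq (μ : ℤ) := restrictSupport_inf_eigenspace_cartan (K := K) Δ μ
  have h0 := eigenspace_eq 0
  have h2 := eigenspace_eq 2
  push_cast at h0 h2
  have hinv : multidegInvariants K Δ = restrictSupport K (multideg ⁻¹' Δ) ⊓
      (toEnd K _ _ (cartan K σ)).eigenspace 0 ⊓ (toEnd K _ _ (polarization K σ 0 1)).ker := by
    ext f
    simp only [multidegInvariants, Submodule.mem_inf, Subalgebra.mem_toSubmodule,
      mem_vectorInvariants_iff_raising, Module.End.mem_eigenspace_iff, LinearMap.mem_ker,
      toEnd_apply_apply, Derivation.bracket_eq_fun, zero_smul]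
    tauto
  have : Module.Finite K ↥(restrictSupport K (multideg ⁻¹' Δ) ⊓
      (toEnd K _ _ (cartan K σ)).eigenspace 0) := by
    rw [h0]
    exact finite_restrictSupport K (hΔ.subset fun m hm => hm.1)
  rw [← finrank_restrictSupport K, ← finrank_restrictSupport K, ← h0, ← h2, hinv]
  exact finrank_ker_lie_e_add_finrank_eigenspace_two isSl2Triple_cartan
    (fun f => polarization_mem_restrictSupport zero_ne_one Δ)
    (fun f => polarization_mem_restrictSupport one_ne_zero Δ)
    (exists_toEnd_polarization_pow_eq_zero zero_ne_one)

end MultidegInvariants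

section Monomials

variable {σ : Type*} [Fintype σ]

theorem finite_setOf_coeffDeg_add_eq (j : ℕ) :
    {m : σ × Fin 2 →₀ ℕ | coeffDeg 0 m + coeffDeg 1 m = j}.Finite := by
  refine (Finsupp.finite_of_degree_le j).subset fun m hm => ?_
  have hdeg : m.degree = coeffDeg 0 m + coeffDeg 1 m := by
    simp [Finsupp.degree_eq_sum, Fintype.sum_prod_type, coeffDeg, Finset.sum_add_distrib]
  exact (hdeg.trans hm).le

/-- A monomial in the coefficients is a pair of monomials in the two kinds of coefficients. -/
noncomputable def splitEquiv (σ : Type*) [Fintype σ] :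
    (σ × Fin 2 →₀ ℕ) ≃ (σ →₀ ℕ) × (σ →₀ ℕ) where
  toFun m := (Finsupp.equivFunOnFinite.symm fun i => m (i, 0),
    Finsupp.equivFunOnFinite.symm fun i => m (i, 1))
  invFun x := Finsupp.equivFunOnFinite.symm fun p => if p.2 = 0 then x.1 p.1 else x.2 p.1
  left_inv m := by
    ext ⟨i, k⟩
    fin_cases k <;> simp
  right_inv x := by
    ext <;> simp

theorem ncard_setOf_coeffDeg_eq (a b : ℕ) :
    {m : σ × Fin 2 →₀ ℕ | coeffDeg 0 m = a ∧ coeffDeg 1 m = b}.ncard =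
      (Fintype.card σ).multichoose a * (Fintype.card σ).multichoose b := by
  classical
  have h : {m : σ × Fin 2 →₀ ℕ | coeffDeg 0 m = a ∧ coeffDeg 1 m = b} =
      splitEquiv σ ⁻¹' ((Finset.univ.finsuppAntidiag a ×ˢ Finset.univ.finsuppAntidiag b :
        Finset ((σ →₀ ℕ) × (σ →₀ ℕ))) : Set ((σ →₀ ℕ) × (σ →₀ ℕ))) := by
    ext m
    simp [splitEquiv, coeffDeg, Finset.mem_finsuppAntidiag]
  rw [h, Set.ncard_preimage_of_injective_subset_range (splitEquiv σ).injective (by simp),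
    Set.ncard_coe_finset, Finset.card_product, Finset.card_finsuppAntidiag_nat_eq_multichoose,
    Finset.card_finsuppAntidiag_nat_eq_multichoose, Finset.card_univ]

end Monomials

section Invariants

variable (K : Type*) {σ : Type*} [Field K] [Fintype σ]

theorem finite_preimage_multideg_sum_eq (j : ℕ) :
    (multideg ⁻¹' {δ : σ → ℕ | ∑ i, δ i = j} : Set (σ × Fin 2 →₀ ℕ)).Finite :=
  (finite_setOf_coeffDeg_add_eq j).subset fun m hm => (sum_multideg m).symm.trans hm

theorem setOf_multideg_sum_eq_torusWeight_eq {j a b : ℕ} {μ : ℤ} (hab : a + b = j)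
    (hμ : (a : ℤ) - b = μ) :
    {x : σ × Fin 2 →₀ ℕ | multideg x ∈ {δ : σ → ℕ | ∑ i, δ i = j} ∧ torusWeight x = μ} =
      {x | coeffDeg 0 x = a ∧ coeffDeg 1 x = b} := by
  ext x
  simp only [Set.mem_ofPred_eq, sum_multideg, torusWeight]
  omega

variable [CharZero K] [Nonempty σ]

theorem finrank_multidegInvariants_zero :
    Module.finrank K (multidegInvariants K {δ : σ → ℕ | ∑ i, δ i = 0}) = 1 := by
  have h := finrank_multidegInvariants_add_ncard K (finite_preimage_multideg_sum_eq (σ := σ) 0)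
  have hempty : {x : σ × Fin 2 →₀ ℕ | multideg x ∈ {δ : σ → ℕ | ∑ i, δ i = 0} ∧
      torusWeight x = 2} = ∅ := by
    ext x
    simp only [Set.mem_ofPred_eq, sum_multideg, torusWeight, Set.mem_empty_iff_false, iff_false]
    omega
  rwa [hempty, Set.ncard_empty, add_zero,
    setOf_multideg_sum_eq_torusWeight_eq (a := 0) (b := 0) (add_zero 0) (sub_self _),
    ncard_setOf_coeffDeg_eq, Nat.multichoose_zero_right, mul_one] at h

theorem finrank_multidegInvariants_even (m : ℕ) :
    Module.finrank K (multidegInvariants K {δ : σ → ℕ | ∑ i, δ i = 2 * (m + 1)}) +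
      (Fintype.card σ).multichoose (m + 2) * (Fintype.card σ).multichoose m =
      (Fintype.card σ).multichoose (m + 1) * (Fintype.card σ).multichoose (m + 1) := by
  have h := finrank_multidegInvariants_add_ncard K
    (finite_preimage_multideg_sum_eq (σ := σ) (2 * (m + 1)))
  rwa [setOf_multideg_sum_eq_torusWeight_eq (a := m + 2) (b := m) (by omega) (by push_cast; ring),
    setOf_multideg_sum_eq_torusWeight_eq (a := m + 1) (b := m + 1) (by omega) (sub_self _),
    ncard_setOf_coeffDeg_eq, ncard_setOf_coeffDeg_eq] at h

theorem finrank_multidegInvariants_odd (m : ℕ) :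
    Module.finrank K (multidegInvariants K {δ : σ → ℕ | ∑ i, δ i = 2 * m + 1}) = 0 := by
  have h := finrank_multidegInvariants_add_ncard K
    (finite_preimage_multideg_sum_eq (σ := σ) (2 * m + 1))
  have hodd : {x : σ × Fin 2 →₀ ℕ | multideg x ∈ {δ : σ → ℕ | ∑ i, δ i = 2 * m + 1} ∧
      torusWeight x = 0} = ∅ := by
    ext x
    simp only [Set.mem_ofPred_eq, sum_multideg, torusWeight, Set.mem_empty_iff_false, iff_false]
    omega
  rw [hodd, Set.ncard_empty] at h
  exact (Nat.add_eq_zero_iff.1 h).1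

end Invariants

section Count

variable {α : Type*} {A : Set α}

/-- Cancelling the shift `(x, u, v + 1) ↦ (x, u + 1, v)` between the two sets of triples leaves the
triples with `v = 0` on the left and those with `u = 0` on the right. -/
theorem ncard_triples_add_ncard (hA : A.Finite) {w : α → ℤ} {N : ℕ} (hN : ∀ x ∈ A, |w x| ≤ N) :
    {x : α × ℕ × ℕ | x.1 ∈ A ∧ x.2.1 + x.2.2 ≤ N ∧ w x.1 + x.2.1 - x.2.2 = 0}.ncard +
      {x ∈ A | 2 ≤ w x}.ncard =
    {x : α × ℕ × ℕ | x.1 ∈ A ∧ x.2.1 + x.2.2 ≤ N ∧ w x.1 + x.2.1 - x.2.2 = 2}.ncard +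
      {x ∈ A | w x ≤ 0}.ncard := by
  set T := {x : α × ℕ × ℕ | x.1 ∈ A ∧ x.2.1 + x.2.2 + 1 ≤ N ∧ w x.1 + x.2.1 - x.2.2 = 1} with hT
  have hTfin : T.Finite := by
    refine (hA.prod ((Set.finite_Iic N).prod (Set.finite_Iic N))).subset fun ⟨x, u, v⟩ h => ?_
    simp only [hT, Set.mem_ofPred_eq, Set.mem_prod, Set.mem_Iic] at h ⊢
    exact ⟨h.1, by omega, by omega⟩
  have ncard_eq {S : Set (α × ℕ × ℕ)} {B : Set α} {s : α × ℕ × ℕ → α × ℕ × ℕ} {t : α → α × ℕ × ℕ}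
      (hS : S = s '' T ∪ t '' B) (hB : B ⊆ A) (hs : s.Injective) (ht : t.Injective)
      (hst : ∀ x y, s x ≠ t y) : S.ncard = T.ncard + B.ncard := by
    rw [hS, Set.ncard_union_eq (Set.disjoint_image_image fun x _ y _ => hst x y) (hTfin.image s)
      ((hA.subset hB).image t), Set.ncard_image_of_injective _ hs,
      Set.ncard_image_of_injective _ ht]
  have h0 : {x : α × ℕ × ℕ | x.1 ∈ A ∧ x.2.1 + x.2.2 ≤ N ∧ w x.1 + x.2.1 - x.2.2 = 0}.ncard =
      T.ncard + {x ∈ A | w x ≤ 0}.ncard := by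
    refine ncard_eq (s := fun x => (x.1, x.2.1, x.2.2 + 1)) (t := fun x => (x, (-w x).toNat, 0))
      (Set.ext fun ⟨x, u, v⟩ => ⟨?_, ?_⟩) (Set.sep_subset _ _) ?_ ?_ ?_
    · rintro ⟨hx, huv, hw⟩
      rcases v with _ | v
      · exact .inr ⟨x, ⟨hx, by grind⟩, by grind⟩
      · exact .inl ⟨(x, u, v), ⟨hx, by grind⟩, rfl⟩
    · rintro (⟨y, ⟨hx, huv, hw⟩, hy⟩ | ⟨y, ⟨hx, hw⟩, hy⟩) <;> grind
    all_goals grind [Function.Injective]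
  have h2 : {x : α × ℕ × ℕ | x.1 ∈ A ∧ x.2.1 + x.2.2 ≤ N ∧ w x.1 + x.2.1 - x.2.2 = 2}.ncard =
      T.ncard + {x ∈ A | 2 ≤ w x}.ncard := by
    refine ncard_eq (s := fun x => (x.1, x.2.1 + 1, x.2.2)) (t := fun x => (x, 0, (w x - 2).toNat))
      (Set.ext fun ⟨x, u, v⟩ => ⟨?_, ?_⟩) (Set.sep_subset _ _) ?_ ?_ ?_
    · rintro ⟨hx, huv, hw⟩
      rcases u with _ | u
      · exact .inr ⟨x, ⟨hx, by grind⟩, by grind⟩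
      · exact .inl ⟨(x, u, v), ⟨hx, by grind⟩, rfl⟩
    · rintro (⟨y, ⟨hx, huv, hw⟩, hy⟩ | ⟨y, ⟨hx, hw⟩, hy⟩) <;> grind
    all_goals grind [Function.Injective]
  rw [h0, h2, add_right_comm]

theorem ncard_setOf_nonpos_of_symm (hA : A.Finite) {w : α → ℤ} (s : α ≃ α)
    (hsA : ∀ x, s x ∈ A ↔ x ∈ A) (hsw : ∀ x, w (s x) = -w x) :
    {x ∈ A | w x ≤ 0}.ncard =
      {x ∈ A | 2 ≤ w x}.ncard + {x ∈ A | w x = 0 ∨ w x = -1}.ncard := by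
  have hsymm : {x ∈ A | 2 ≤ w x} = s ⁻¹' {x ∈ A | w x ≤ -2} := by
    ext x
    simp only [Set.mem_ofPred_eq, Set.mem_preimage, hsA, hsw, neg_le_neg_iff]
  rw [hsymm, Set.ncard_preimage_of_injective_subset_range s.injective (by simp),
    ← Set.ncard_union_eq _ (hA.subset (Set.sep_subset _ _)) (hA.subset (Set.sep_subset _ _))]
  · congr 1
    ext x
    simp only [Set.mem_ofPred_eq, Set.mem_union, ← and_or_left]
    refine and_congr_right fun _ => ?_
    omega
  · refine Set.disjoint_left.2 fun x hx hx' => ?_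
    simp only [Set.mem_ofPred_eq] at hx hx'
    omega

theorem ncard_triples_of_symm (hA : A.Finite) {w : α → ℤ} {N : ℕ} (hN : ∀ x ∈ A, |w x| ≤ N)
    (s : α ≃ α) (hsA : ∀ x, s x ∈ A ↔ x ∈ A) (hsw : ∀ x, w (s x) = -w x) :
    {x : α × ℕ × ℕ | x.1 ∈ A ∧ x.2.1 + x.2.2 ≤ N ∧ w x.1 + x.2.1 - x.2.2 = 0}.ncard =
      {x ∈ A | w x = 0 ∨ w x = -1}.ncard +
      {x : α × ℕ × ℕ | x.1 ∈ A ∧ x.2.1 + x.2.2 ≤ N ∧ w x.1 + x.2.1 - x.2.2 = 2}.ncard := by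
  have hshift := ncard_triples_add_ncard hA hN
  have hsymm := ncard_setOf_nonpos_of_symm hA s hsA hsw
  omega

end Count

section OneMoreForm

/-- Exchange of the two coefficients of each form. -/
noncomputable def swapEquiv (σ : Type*) : (σ × Fin 2 →₀ ℕ) ≃ (σ × Fin 2 →₀ ℕ) :=
  (Finsupp.domLCongr (R := ℕ) ((Equiv.refl σ).prodCongr (Equiv.swap 0 1))).toEquiv

variable {σ : Type*} [Fintype σ]

theorem coeffDeg_zero_swapEquiv (m : σ × Fin 2 →₀ ℕ) :
    coeffDeg 0 (swapEquiv σ m) = coeffDeg 1 m := by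
  simp [coeffDeg, swapEquiv]

theorem coeffDeg_one_swapEquiv (m : σ × Fin 2 →₀ ℕ) :
    coeffDeg 1 (swapEquiv σ m) = coeffDeg 0 m := by
  simp [coeffDeg, swapEquiv]

/-- A monomial in the coefficients of a family with one additional form. -/
noncomputable def optionEquiv (σ : Type*) [Fintype σ] :
    (Option σ × Fin 2 →₀ ℕ) ≃ (σ × Fin 2 →₀ ℕ) × ℕ × ℕ where
  toFun m := (Finsupp.equivFunOnFinite.symm fun p => m (some p.1, p.2), m (none, 0), m (none, 1))
  invFun x := Finsupp.equivFunOnFinite.symm fun p =>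
    p.1.elim (if p.2 = 0 then x.2.1 else x.2.2) fun i => x.1 (i, p.2)
  left_inv m := by
    ext ⟨i, k⟩
    cases i <;> fin_cases k <;> simp
  right_inv x := by
    ext <;> simp

/-- Multidegrees of total degree `j` in the old forms and degree in `D` in the additional form. -/
def orderedDegrees (σ : Type*) [Fintype σ] (j : ℕ) (D : Set ℕ) : Set (Option σ → ℕ) :=
  {δ | ∑ i, δ (some i) = j ∧ δ none ∈ D}

theorem orderedDegrees_mono {j : ℕ} {D D' : Set ℕ} (h : D ⊆ D') :
    orderedDegrees σ j D ⊆ orderedDegrees σ j D' :=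
  fun _ hδ => ⟨hδ.1, h hδ.2⟩

theorem multideg_mem_orderedDegrees_iff {j : ℕ} {D : Set ℕ} {m : Option σ × Fin 2 →₀ ℕ} :
    multideg m ∈ orderedDegrees σ j D ↔
      coeffDeg 0 (optionEquiv σ m).1 + coeffDeg 1 (optionEquiv σ m).1 = j ∧
        (optionEquiv σ m).2.1 + (optionEquiv σ m).2.2 ∈ D := by
  simp [orderedDegrees, multideg, coeffDeg, optionEquiv, Finset.sum_add_distrib]

theorem torusWeight_eq_optionEquiv (m : Option σ × Fin 2 →₀ ℕ) :
    torusWeight m = torusWeight (optionEquiv σ m).1 + (optionEquiv σ m).2.1 -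
      (optionEquiv σ m).2.2 := by
  simp [torusWeight, coeffDeg, optionEquiv, Fintype.sum_option]
  ring

theorem finite_preimage_orderedDegrees_Iic (j N : ℕ) :
    (multideg ⁻¹' orderedDegrees σ j (Set.Iic N) : Set (Option σ × Fin 2 →₀ ℕ)).Finite := by
  refine (((finite_setOf_coeffDeg_add_eq j).prod
    ((Set.finite_Iic N).prod (Set.finite_Iic N))).preimage
      (optionEquiv σ).injective.injOn).subset fun m hm => ?_
  obtain ⟨hj, hN⟩ := multideg_mem_orderedDegrees_iff.1 hm
  exact ⟨hj, (Nat.le_add_right _ _).trans hN, (Nat.le_add_left _ _).trans hN⟩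

theorem ncard_setOf_orderedDegrees (j N : ℕ) (μ : ℤ) :
    {m : Option σ × Fin 2 →₀ ℕ | multideg m ∈ orderedDegrees σ j (Set.Iic N) ∧
      torusWeight m = μ}.ncard =
    {x : (σ × Fin 2 →₀ ℕ) × ℕ × ℕ | x.1 ∈ {m | coeffDeg 0 m + coeffDeg 1 m = j} ∧
      x.2.1 + x.2.2 ≤ N ∧ torusWeight x.1 + x.2.1 - x.2.2 = μ}.ncard := by
  rw [← Set.ncard_preimage_of_injective_subset_range (optionEquiv σ).injective (by simp)]
  congr 1
  ext m
  rw [Set.mem_ofPred_eq, multideg_mem_orderedDegrees_iff, torusWeight_eq_optionEquiv, and_assoc]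
  rfl

variable (K : Type*) [Field K]

theorem finite_multidegInvariants_Iic (j N : ℕ) :
    Module.Finite K (multidegInvariants K (orderedDegrees σ j (Set.Iic N))) :=
  finite_multidegInvariants K (finite_preimage_orderedDegrees_Iic j N)

variable [CharZero K]

theorem finrank_multidegInvariants_Iic {j N : ℕ} (hjN : j ≤ N) :
    Module.finrank K (multidegInvariants K (orderedDegrees σ j (Set.Iic N))) =
      (Fintype.card σ).multichoose (j / 2) * (Fintype.card σ).multichoose ((j + 1) / 2) := by
  have hdim := finrank_multidegInvariants_add_ncard K
    (finite_preimage_orderedDegrees_Iic (σ := σ) j N)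
  have hcount := ncard_triples_of_symm (finite_setOf_coeffDeg_add_eq (σ := σ) j) (N := N)
    (w := torusWeight)
    (fun m hm => by simp only [Set.mem_ofPred_eq, torusWeight] at hm ⊢; rw [abs_le]; omega)
    (swapEquiv σ)
    (fun m => by simp [coeffDeg_zero_swapEquiv, coeffDeg_one_swapEquiv, add_comm])
    (fun m => by simp [torusWeight, coeffDeg_zero_swapEquiv, coeffDeg_one_swapEquiv])
  have hbalanced : {m : σ × Fin 2 →₀ ℕ | m ∈ {m | coeffDeg 0 m + coeffDeg 1 m = j} ∧
      (torusWeight m = 0 ∨ torusWeight m = -1)} =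
      {m | coeffDeg 0 m = j / 2 ∧ coeffDeg 1 m = (j + 1) / 2} := by
    ext m
    simp only [Set.mem_ofPred_eq, torusWeight]
    omega
  rw [hbalanced, ncard_setOf_coeffDeg_eq] at hcount
  rw [ncard_setOf_orderedDegrees, ncard_setOf_orderedDegrees] at hdim
  omega

theorem multidegInvariants_univ_eq_Iic (j : ℕ) :
    multidegInvariants K (orderedDegrees σ j Set.univ) =
      multidegInvariants K (orderedDegrees σ j (Set.Iic j)) := by
  refine le_antisymm (fun f hf => ?_)
    (multidegInvariants_mono (orderedDegrees_mono (Set.subset_univ _)))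
  set N := max j (f.support.sup fun m => multideg m none)
  have hfN : f ∈ multidegInvariants K (orderedDegrees σ j (Set.Iic N)) :=
    ⟨hf.1, fun m hm => ⟨(hf.2 hm).1, le_max_of_le_right
      (Finset.le_sup (f := fun m : Option σ × Fin 2 →₀ ℕ => multideg m none) hm)⟩⟩
  have hjN : j ≤ N := le_max_left _ _
  have := finite_multidegInvariants_Iic (σ := σ) K j N
  rwa [Submodule.eq_of_le_of_finrank_eq
    (multidegInvariants_mono (orderedDegrees_mono (Set.Iic_subset_Iic.2 hjN)))
    ((finrank_multidegInvariants_Iic K le_rfl).trans (finrank_multidegInvariants_Iic K hjN).symm)]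

theorem finite_multidegInvariants_univ (j : ℕ) :
    Module.Finite K (multidegInvariants K (orderedDegrees σ j Set.univ)) := by
  rw [multidegInvariants_univ_eq_Iic]
  exact finite_multidegInvariants_Iic K j j

theorem finrank_multidegInvariants_univ (j : ℕ) :
    Module.finrank K (multidegInvariants K (orderedDegrees σ j Set.univ)) =
      (Fintype.card σ).multichoose (j / 2) * (Fintype.card σ).multichoose ((j + 1) / 2) := by
  rw [multidegInvariants_univ_eq_Iic, finrank_multidegInvariants_Iic K le_rfl]

end OneMoreForm

theorem trdeg_eq_of_isAlgebraic (K : Type*) (R S : Type u) [Field K] [CommRing R] [CommRing S]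
    [IsDomain S] [Algebra K R] [Algebra K S] [Algebra R S] [IsScalarTower K R S] [FaithfulSMul R S]
    [Algebra.IsAlgebraic R S] : Algebra.trdeg K R = Algebra.trdeg K S := by
  have : IsDomain R := (FaithfulSMul.algebraMap_injective R S).isDomain _
  rw [← trdeg_add_eq K R (A := S), trdeg_eq_zero (R := R) (A := S), add_zero]

theorem trdeg_fractionRing (K R : Type*) [Field K] [CommRing R] [IsDomain R] [Algebra K R] :
    Algebra.trdeg K (FractionRing R) = Algebra.trdeg K R :=
  have : Algebra.IsAlgebraic R (FractionRing R) := IsLocalization.isAlgebraic _ (nonZeroDivisors R)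
  (trdeg_eq_of_isAlgebraic K R (FractionRing R)).symm

section Bracket

variable {K σ : Type*} [CommRing K]

/-- The bracket invariant of the forms with indices `i` and `j`: their determinant. -/
noncomputable def bracket (K : Type*) {σ : Type*} [CommRing K] (i j : σ) :
    MvPolynomial (σ × Fin 2) K :=
  X (i, 0) * X (j, 1) - X (i, 1) * X (j, 0)

theorem eval_bracket (c : σ → Fin 2 → K) (i j : σ) :
    eval (fun p => c p.1 p.2) (bracket K i j) = c i 0 * c j 1 - c i 1 * c j 0 := by
  simp [bracket]

theorem bracket_mem_vectorInvariants (i j : σ) : bracket K i j ∈ vectorInvariants K σ := by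
  intro g c
  have hdet : g.1 0 0 * g.1 1 1 - g.1 0 1 * g.1 1 0 = 1 := by rw [← det_fin_two, g.2]
  rw [eval_bracket (fun i => c i ᵥ* g.1), eval_bracket]
  simp only [vecMul, dotProduct, Fin.sum_univ_two]
  linear_combination (c i 0 * c j 1 - c i 1 * c j 0) * hdet

end Bracket

theorem exists_vecMul_eq_of_bracket_ne_zero {K : Type*} [Field K] {u v : Fin 2 → K}
    (h : u 0 * v 1 - u 1 * v 0 ≠ 0) :
    ∃ g : SpecialLinearGroup (Fin 2) K,
      u ᵥ* g.1 = ![1, 0] ∧ v ᵥ* g.1 = ![0, u 0 * v 1 - u 1 * v 0] := by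
  set t := u 0 * v 1 - u 1 * v 0 with ht
  refine ⟨⟨!![v 1 / t, -u 1; -v 0 / t, u 0], ?_⟩, ?_, ?_⟩
  · rw [det_fin_two_of]
    field_simp
    rw [ht]
    ring
  all_goals
    ext k
    fin_cases k <;> simp [vecMul, dotProduct, Fin.sum_univ_two] <;> grind

section Slice

/-- Coordinates on the normal form of a family whose forms `i₀`, `i₁` are independent: the
coefficients of the other forms and the bracket of `i₀` and `i₁`. -/
abbrev SliceIndex {σ : Type*} (i₀ i₁ : σ) : Type _ := Option ({i : σ // i ≠ i₀ ∧ i ≠ i₁} × Fin 2)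

theorem card_sliceIndex {σ : Type*} [Fintype σ] {i₀ i₁ : σ} (h : i₀ ≠ i₁) :
    Nat.card (SliceIndex i₀ i₁) = 2 * (Fintype.card σ - 2) + 1 := by
  classical
  have hcompl : (Finset.univ.filter fun i => i ≠ i₀ ∧ i ≠ i₁) = {i₀, i₁}ᶜ := by
    ext i
    simp
  rw [Nat.card_eq_fintype_card, Fintype.card_option, Fintype.card_prod, Fintype.card_fin,
    Fintype.card_subtype, mul_comm, hcompl, Finset.card_compl, Finset.card_pair h]

variable {K σ : Type*} [Field K]

open Classical in
/-- Restriction of polynomials to families with `i₀`-th form `X` and `i₁`-th form a multiple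
of `Y`. -/
noncomputable def slice (K : Type*) {σ : Type*} [CommRing K] (i₀ i₁ : σ) :
    MvPolynomial (σ × Fin 2) K →ₐ[K] MvPolynomial (SliceIndex i₀ i₁) K :=
  aeval fun p =>
    if h : p.1 ≠ i₀ ∧ p.1 ≠ i₁ then X (some (⟨p.1, h⟩, p.2))
    else if p.1 = i₀ then if p.2 = 0 then 1 else 0
    else if p.2 = 0 then 0 else X none

variable {i₀ i₁ : σ}

theorem slice_X_fst (k : Fin 2) : slice K i₀ i₁ (X (i₀, k)) = if k = 0 then 1 else 0 := by
  simp [slice]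

theorem slice_X_snd (h : i₀ ≠ i₁) (k : Fin 2) :
    slice K i₀ i₁ (X (i₁, k)) = if k = 0 then 0 else X none := by
  simp [slice, h.symm]

theorem slice_X (i : {i : σ // i ≠ i₀ ∧ i ≠ i₁}) (k : Fin 2) :
    slice K i₀ i₁ (X (i.1, k)) = X (some (i, k)) := by
  simp [slice, i.2]

theorem slice_bracket (h : i₀ ≠ i₁) : slice K i₀ i₁ (bracket K i₀ i₁) = X none := by
  simp [bracket, slice_X_fst, slice_X_snd h]

theorem eval_slice (h : i₀ ≠ i₁) {c : σ → Fin 2 → K} {t : K} (h₀ : c i₀ = ![1, 0])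
    (h₁ : c i₁ = ![0, t]) (f : MvPolynomial (σ × Fin 2) K) :
    eval (fun s => s.elim t fun p => c p.1 p.2) (slice K i₀ i₁ f) =
      eval (fun p => c p.1 p.2) f := by
  induction f using MvPolynomial.induction_on with
  | C r => simp [slice]
  | add p q hp hq => simp only [map_add, hp, hq]
  | mul_X f p hf =>
    obtain ⟨i, k⟩ := p
    rw [map_mul, map_mul, map_mul, hf, eval_X]
    congr 1
    rcases eq_or_ne i i₀ with rfl | hi₀
    · fin_cases k <;> simp [slice_X_fst, h₀]
    rcases eq_or_ne i i₁ with rfl | hi₁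
    · fin_cases k <;> simp [slice_X_snd h, h₁]
    · simp [slice_X ⟨i, hi₀, hi₁⟩]

theorem eval_mul_bracket_eq_zero (h : i₀ ≠ i₁) {f : MvPolynomial (σ × Fin 2) K}
    (hf : f ∈ vectorInvariants K σ) (hs : slice K i₀ i₁ f = 0) (c : σ → Fin 2 → K) :
    eval (fun p => c p.1 p.2) (f * bracket K i₀ i₁) = 0 := by
  rw [map_mul, eval_bracket, mul_eq_zero, or_iff_not_imp_right]
  intro ht
  obtain ⟨g, h₀, h₁⟩ := exists_vecMul_eq_of_bracket_ne_zero ht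
  rw [← hf g c, ← eval_slice h (c := fun i => c i ᵥ* g.1) h₀ h₁, hs, map_zero]

theorem slice_injective [Infinite K] (h : i₀ ≠ i₁) :
    Function.Injective ((slice K i₀ i₁).comp (vectorInvariants K σ).val) := by
  rw [injective_iff_map_eq_zero]
  rintro ⟨f, hf⟩ hs
  have hmul : f * bracket K i₀ i₁ = 0 :=
    MvPolynomial.funext fun x => eval_mul_bracket_eq_zero h hf hs fun i k => x (i, k)
  have hbracket : bracket K i₀ i₁ ≠ 0 :=
    ne_zero_of_map (f := slice K i₀ i₁) (slice_bracket (K := K) h ▸ X_ne_zero none)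
  exact Subtype.ext ((mul_eq_zero.1 hmul).resolve_right hbracket)

theorem isAlgebraic_range_slice (h : i₀ ≠ i₁) :
    Algebra.IsAlgebraic ((slice K i₀ i₁).comp (vectorInvariants K σ).val).range
      (MvPolynomial (SliceIndex i₀ i₁) K) := by
  set A := ((slice K i₀ i₁).comp (vectorInvariants K σ).val).range
  have isAlgebraic_slice_bracket (i j : σ) : IsAlgebraic A (slice K i₀ i₁ (bracket K i j)) :=
    isAlgebraic_algebraMap (⟨_, ⟨_, bracket_mem_vectorInvariants i j⟩, rfl⟩ : A)
  have hnone : IsAlgebraic A (X none : MvPolynomial (SliceIndex i₀ i₁) K) :=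
    slice_bracket (K := K) h ▸ isAlgebraic_slice_bracket i₀ i₁
  have hsome (i : {i : σ // i ≠ i₀ ∧ i ≠ i₁}) (k : Fin 2) :
      IsAlgebraic A (X (some (i, k)) : MvPolynomial (SliceIndex i₀ i₁) K) := by
    fin_cases k
    · have h₁ := isAlgebraic_slice_bracket i.1 i₁
      rw [show slice K i₀ i₁ (bracket K i.1 i₁) = X none * X (some (i, 0)) by
        simp [bracket, slice_X_snd h, slice_X, mul_comm]] at h₁
      exact .of_mul (mem_nonZeroDivisors_of_ne_zero (X_ne_zero none)) hnone h₁
    · simpa [bracket, slice_X_fst, slice_X] using isAlgebraic_slice_bracket i₀ i.1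
  refine ⟨fun f => ?_⟩
  induction f using MvPolynomial.induction_on with
  | C r => exact isAlgebraic_algebraMap (algebraMap K A r)
  | add p q hp hq => exact hp.add hq
  | mul_X p s hp =>
    match s with
    | none => exact hp.mul hnone
    | some (i, k) => exact hp.mul (hsome i k)

theorem trdeg_vectorInvariants [Infinite K] [Fintype σ] (h : i₀ ≠ i₁) :
    Algebra.trdeg K (vectorInvariants K σ) = (2 * (Fintype.card σ - 2) + 1 : ℕ) := by
  have := isAlgebraic_range_slice (K := K) h
  rw [(AlgEquiv.ofInjective _ (slice_injective h)).trdeg_eq,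
    trdeg_eq_of_isAlgebraic K _ (MvPolynomial (SliceIndex i₀ i₁) K),
    MvPolynomial.trdeg_of_isDomain, ← card_sliceIndex h, ← Nat.cast_card, Cardinal.lift_natCast]

theorem vectorInvariants_eq_bot [Infinite K] [Unique σ] : vectorInvariants K σ = ⊥ := by
  rw [eq_bot_iff]
  intro f hf
  set r := eval (fun p : σ × Fin 2 => (![1, 0] : Fin 2 → K) p.2) f
  have hmul : (f - C r) * X (default, 0) = 0 := by
    refine MvPolynomial.funext fun x => ?_
    rw [map_mul, map_sub, eval_C, eval_X, map_zero, mul_eq_zero, sub_eq_zero,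
      or_iff_not_imp_right]
    intro hx
    obtain ⟨g, hg, -⟩ := exists_vecMul_eq_of_bracket_ne_zero
      (u := fun k => x (default, k)) (v := ![0, 1]) (by simpa using hx)
    refine (hf g fun i k => x (i, k)).symm.trans (congrArg (eval · f) (funext fun ⟨i, k⟩ => ?_))
    rw [Unique.eq_default i, ← hg]
  exact Algebra.mem_bot.2
    ⟨r, (sub_eq_zero.1 ((mul_eq_zero.1 hmul).resolve_right (X_ne_zero _))).symm⟩

theorem trdeg_vectorInvariants_of_unique [Infinite K] [Unique σ] :
    Algebra.trdeg K (vectorInvariants K σ) = 0 := by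
  rw [vectorInvariants_eq_bot, trdeg_eq_zero]

end Slice

theorem isWeightedHomogeneous_aeval {R M α β : Type*} [CommSemiring R] [AddCommMonoid M]
    {w : α → M} {w' : β → M} {g : α → MvPolynomial β R}
    (hg : ∀ s, IsWeightedHomogeneous w' (g s) (w s)) {f : MvPolynomial α R} {j : M}
    (hf : IsWeightedHomogeneous w f j) : IsWeightedHomogeneous w' (aeval g f) j := by
  rw [aeval_def, eval₂_eq]
  refine IsWeightedHomogeneous.sum _ _ _ fun m hm => IsWeightedHomogeneous.C_mul ?_ _
  rw [← hf (mem_support_iff.1 hm)]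
  exact IsWeightedHomogeneous.prod m.support (fun s => g s ^ m s) (fun s => m s • w s)
    fun s _ => (hg s).pow (m s)

theorem weight_comp_fst {σ : Type*} [Fintype σ] (w : σ → ℕ) (m : σ × Fin 2 →₀ ℕ) :
    Finsupp.weight (fun p => w p.1) m = ∑ i, multideg m i * w i := by
  rw [Finsupp.weight_apply, Finsupp.sum_fintype _ _ (by simp), Fintype.sum_prod_type]
  simp [multideg, add_mul]

section CovariantEquiv

variable (K σ : Type*) [CommRing K]

/-- The equivariant identification of a vector `x` with the linear form `x 1 * X - x 0 * Y`,
on polynomial functions. It turns covariants of a family of forms into invariants of the family with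
one additional form. -/
noncomputable def covariantEquiv :
    MvPolynomial ((σ × Fin 2) ⊕ Fin 2) K ≃ₐ[K] MvPolynomial (Option σ × Fin 2) K :=
  AlgEquiv.ofAlgHom
    (aeval (Sum.elim (fun p => X (some p.1, p.2)) ![-X (none, 1), X (none, 0)]))
    (aeval fun p => p.1.elim (![X (Sum.inr 1), -X (Sum.inr 0)] p.2) fun i => X (Sum.inl (i, p.2)))
    (by
      refine algHom_ext fun p => ?_
      obtain ⟨_ | i, k⟩ := p
      · fin_cases k <;> simp
      · simp)
    (by
      refine algHom_ext fun s => ?_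
      rcases s with ⟨i, k⟩ | k
      · simp
      · fin_cases k <;> simp)

variable {K σ}

theorem eval_covariantEquiv (c : Option σ → Fin 2 → K) (f : MvPolynomial ((σ × Fin 2) ⊕ Fin 2) K) :
    eval (fun p => c p.1 p.2) (covariantEquiv K σ f) =
      eval (Sum.elim (fun p => c (some p.1) p.2) ![-c none 1, c none 0]) f := by
  rw [← coe_aeval_eq_eval, ← coe_aeval_eq_eval]
  change ((aeval _).comp (covariantEquiv K σ).toAlgHom) f = (aeval _) f
  congr 1
  refine algHom_ext fun s => ?_
  rcases s with ⟨i, k⟩ | k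
  · simp [covariantEquiv]
  · fin_cases k <;> simp [covariantEquiv]

theorem isWeightedHomogeneous_covariantEquiv_iff {f : MvPolynomial ((σ × Fin 2) ⊕ Fin 2) K}
    {j : ℕ} :
    IsWeightedHomogeneous (fun p => p.1.elim 0 fun _ => 1) (covariantEquiv K σ f) j ↔
      IsWeightedHomogeneous (Sum.elim (fun _ => 1) fun _ => 0) f j := by
  constructor <;> intro h
  · rw [← (covariantEquiv K σ).symm_apply_apply f]
    refine isWeightedHomogeneous_aeval ?_ h
    rintro ⟨_ | i, k⟩
    · fin_cases k
      · exact isWeightedHomogeneous_X K _ _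
      · exact (isWeightedHomogeneous_X K _ _).neg
    · exact isWeightedHomogeneous_X K _ _
  · refine isWeightedHomogeneous_aeval ?_ h
    rintro (p | k)
    · exact isWeightedHomogeneous_X K _ _
    · fin_cases k
      · exact (isWeightedHomogeneous_X K _ _).neg
      · exact isWeightedHomogeneous_X K _ _

end CovariantEquiv

section JointInvariants

theorem mem_vectorInvariants_iff_formAct {σ : Type*} {f : MvPolynomial (σ × Fin 2) ℂ} :
    f ∈ vectorInvariants ℂ σ ↔ ∀ (g : SpecialLinearGroup (Fin 2) ℂ) (c : σ → Fin 2 → ℂ),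
      eval (fun p => formAct g (c p.1) p.2) f = eval (fun p => c p.1 p.2) f :=
  ⟨fun h g c => h g⁻¹ c, fun h g c => by simpa only [formAct, inv_inv] using h g⁻¹ c⟩

theorem jointInvariants_eq (n : ℕ) : jointInvariants n = vectorInvariants ℂ (Fin n) :=
  Subalgebra.ext fun _ => mem_vectorInvariants_iff_formAct.symm

theorem map_invariantsGrading (n j : ℕ) :
    (invariantsGrading n j).map (jointInvariants n).val.toLinearMap =
      multidegInvariants ℂ {δ : Fin n → ℕ | ∑ i, δ i = j} := by
  have hdeg : homogeneousSubmodule (Fin n × Fin 2) ℂ j =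
      restrictSupport ℂ (multideg ⁻¹' {δ : Fin n → ℕ | ∑ i, δ i = j}) := by
    rw [homogeneousSubmodule_eq_finsupp_supported]
    refine congrArg (restrictSupport ℂ) (Set.ext fun m => ?_)
    simp [Finsupp.degree_eq_sum, Fintype.sum_prod_type, multideg]
  rw [multidegInvariants, ← jointInvariants_eq, ← hdeg]
  exact Submodule.map_comap_subtype (Subalgebra.toSubmodule (jointInvariants n)) _

theorem finite_invariantsGrading (n j : ℕ) : Module.Finite ℂ (invariantsGrading n j) := by
  have := finite_multidegInvariants ℂ (finite_preimage_multideg_sum_eq (σ := Fin n) j)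
  rw [← map_invariantsGrading] at this
  exact .equiv (Submodule.equivMapOfInjective (jointInvariants n).val.toLinearMap
    Subtype.val_injective _).symm

theorem finrank_invariantsGrading (n j : ℕ) :
    Module.finrank ℂ (invariantsGrading n j) =
      Module.finrank ℂ (multidegInvariants ℂ {δ : Fin n → ℕ | ∑ i, δ i = j}) := by
  rw [← map_invariantsGrading]
  exact (Submodule.equivMapOfInjective (jointInvariants n).val.toLinearMap
    Subtype.val_injective _).finrank_eq

theorem trdeg_jointInvariants_one :
    Algebra.trdeg ℂ (jointInvariants 1) = 0 := by
  rw [jointInvariants_eq, trdeg_vectorInvariants_of_unique]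

theorem trdeg_jointInvariants (N : ℕ) :
    Algebra.trdeg ℂ (jointInvariants (N + 2)) = (2 * N + 1 : ℕ) := by
  rw [jointInvariants_eq, trdeg_vectorInvariants (zero_ne_one (α := Fin (N + 2))), Fintype.card_fin,
    Nat.add_sub_cancel]

end JointInvariants

section JointCovariants

theorem formAct_rotate (g : SpecialLinearGroup (Fin 2) ℂ) (c : Fin 2 → ℂ) :
    ![-formAct g c 1, formAct g c 0] =
      (g : Matrix (Fin 2) (Fin 2) ℂ) *ᵥ ![-c 1, c 0] := by
  change ![-(c ᵥ* adjugate g.1) 1, (c ᵥ* adjugate g.1) 0] = g.1 *ᵥ ![-c 1, c 0]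
  rw [adjugate_fin_two]
  funext k
  fin_cases k <;> simp [Matrix.vecMul, Matrix.mulVec, dotProduct, Fin.sum_univ_two] <;> ring

theorem covariantEquiv_mem_iff {n : ℕ} {f : MvPolynomial ((Fin n × Fin 2) ⊕ Fin 2) ℂ} :
    covariantEquiv ℂ (Fin n) f ∈ vectorInvariants ℂ (Option (Fin n)) ↔ f ∈ jointCovariants n := by
  rw [mem_vectorInvariants_iff_formAct]
  constructor
  · intro h g c x
    have hinv := h g fun o => o.elim ![x 1, -x 0] c
    rw [eval_covariantEquiv fun o => formAct g (o.elim ![x 1, -x 0] c),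
      eval_covariantEquiv fun o => o.elim ![x 1, -x 0] c, formAct_rotate] at hinv
    have hx : x = ![x 0, x 1] := by ext k; fin_cases k <;> rfl
    rw [hx]
    simpa using hinv
  · intro h g c
    rw [eval_covariantEquiv fun o => formAct g (c o), eval_covariantEquiv c, formAct_rotate]
    exact h g (fun i => c (some i)) _

theorem map_jointCovariants (n : ℕ) :
    (jointCovariants n).map (covariantEquiv ℂ (Fin n) : _ →ₐ[ℂ] _) =
      vectorInvariants ℂ (Option (Fin n)) := by
  ext f
  obtain ⟨f, rfl⟩ := (covariantEquiv ℂ (Fin n)).surjective f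
  rw [covariantEquiv_mem_iff]
  exact (covariantEquiv ℂ (Fin n)).injective.mem_set_image

theorem restrictSupport_orderedDegrees_univ (σ : Type*) [Fintype σ] (j : ℕ) :
    restrictSupport ℂ (multideg ⁻¹' orderedDegrees σ j Set.univ) =
      weightedHomogeneousSubmodule ℂ (fun p : Option σ × Fin 2 => p.1.elim 0 fun _ => 1) j := by
  rw [weightedHomogeneousSubmodule_eq_finsupp_supported]
  refine congrArg (restrictSupport ℂ) (Set.ext fun m => ?_)
  rw [Set.mem_ofPred_eq, weight_comp_fst (fun o : Option σ => o.elim 0 fun _ => 1)]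
  simp [orderedDegrees, Fintype.sum_option]

theorem map_covariantsGrading (n j : ℕ) :
    (covariantsGrading n j).map
      ((covariantEquiv ℂ (Fin n)).toLinearMap ∘ₗ (jointCovariants n).val.toLinearMap) =
      multidegInvariants ℂ (orderedDegrees (Fin n) j Set.univ) := by
  ext f
  obtain ⟨f, rfl⟩ := (covariantEquiv ℂ (Fin n)).surjective f
  rw [multidegInvariants, restrictSupport_orderedDegrees_univ, Submodule.mem_inf,
    Subalgebra.mem_toSubmodule, covariantEquiv_mem_iff, mem_weightedHomogeneousSubmodule,
    isWeightedHomogeneous_covariantEquiv_iff, Submodule.mem_map]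
  constructor
  · rintro ⟨f', hf', h⟩
    obtain rfl := (covariantEquiv ℂ (Fin n)).injective h
    exact ⟨f'.2, hf'⟩
  · rintro ⟨hf, hfj⟩
    exact ⟨⟨f, hf⟩, hfj, rfl⟩

theorem covariantEquiv_comp_val_injective (n : ℕ) : Function.Injective
    ((covariantEquiv ℂ (Fin n)).toLinearMap ∘ₗ (jointCovariants n).val.toLinearMap) :=
  (covariantEquiv ℂ (Fin n)).injective.comp Subtype.val_injective

theorem finite_covariantsGrading (n j : ℕ) : Module.Finite ℂ (covariantsGrading n j) := by
  have := finite_multidegInvariants_univ (σ := Fin n) ℂ j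
  rw [← map_covariantsGrading] at this
  exact .equiv (Submodule.equivMapOfInjective _ (covariantEquiv_comp_val_injective n) _).symm

theorem finrank_covariantsGrading (n j : ℕ) :
    Module.finrank ℂ (covariantsGrading n j) =
      n.multichoose (j / 2) * n.multichoose ((j + 1) / 2) := by
  rw [(Submodule.equivMapOfInjective _ (covariantEquiv_comp_val_injective n) _).finrank_eq,
    map_covariantsGrading, finrank_multidegInvariants_univ, Fintype.card_fin]

theorem trdeg_jointCovariants (N : ℕ) :
    Algebra.trdeg ℂ (jointCovariants (N + 1)) = (2 * N + 1 : ℕ) := by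
  rw [((covariantEquiv ℂ (Fin (N + 1))).subalgebraMap (jointCovariants (N + 1))).trdeg_eq,
    map_jointCovariants, trdeg_vectorInvariants (Option.some_ne_none (0 : Fin (N + 1))),
    Fintype.card_option, Fintype.card_fin, show N + 1 + 1 - 2 = N by omega]

end JointCovariants

section Abel

theorem isLittleO_tsum_mul_pow {a b : ℕ → ℝ} (hb : ∀ m, 0 ≤ b m) (hab : a =o[atTop] b)
    (hsum : ∀ x ∈ Set.Ioo (0 : ℝ) 1, Summable fun m => b m * x ^ m)
    (hlim : Tendsto (fun x : ℝ => ∑' m, b m * x ^ m) (𝓝[<] 1) atTop) :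
    (fun x : ℝ => ∑' m, a m * x ^ m) =o[𝓝[<] 1] fun x => ∑' m, b m * x ^ m := by
  refine isLittleO_iff.2 fun ε hε => ?_
  obtain ⟨N, hN⟩ := eventually_atTop.1 (isLittleO_iff.1 hab (half_pos hε))
  set C : ℝ := ∑ m ∈ Finset.range N, |a m|
  filter_upwards [hlim.eventually_ge_atTop (C / (ε / 2)), Ioo_mem_nhdsLT (zero_lt_one' ℝ)]
    with x hC hx
  have hhead : HasSum (fun m => if m ∈ Finset.range N then |a m| else 0) C := by
    simpa only [Finset.sum_ite_mem, Finset.inter_self] using hasSum_sum_of_ne_finset_zero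
      (f := fun m => if m ∈ Finset.range N then |a m| else 0) fun m hm => if_neg hm
  have hbound (m : ℕ) : ‖a m * x ^ m‖ ≤
      (if m ∈ Finset.range N then |a m| else 0) + ε / 2 * (b m * x ^ m) := by
    have hx0 : 0 ≤ x ^ m := pow_nonneg hx.1.le m
    rw [norm_mul, Real.norm_of_nonneg hx0, Real.norm_eq_abs]
    split_ifs with hm
    · exact (mul_le_of_le_one_right (abs_nonneg _) (pow_le_one₀ hx.1.le hx.2.le)).trans
        (le_add_of_nonneg_right (by have := hb m; positivity))
    · rw [zero_add, ← mul_assoc]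
      have := hN m (by simpa using hm)
      rw [Real.norm_of_nonneg (hb m)] at this
      exact mul_le_mul_of_nonneg_right this hx0
  calc ‖∑' m, a m * x ^ m‖
      ≤ C + ε / 2 * ∑' m, b m * x ^ m :=
        tsum_of_norm_bounded (hhead.add ((hsum x hx).hasSum.mul_left _)) hbound
    _ ≤ ε / 2 * (∑' m, b m * x ^ m) + ε / 2 * ∑' m, b m * x ^ m := by
        gcongr
        exact (div_le_iff₀' (half_pos hε)).1 hC
    _ = ε * ∑' m, b m * x ^ m := by ring
    _ = ε * ‖∑' m, b m * x ^ m‖ := by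
        rw [Real.norm_of_nonneg (tsum_nonneg fun m => mul_nonneg (hb m) (pow_nonneg hx.1.le m))]

variable {a : ℕ → ℝ} {k : ℕ} {L : ℝ}

theorem hasSum_choose_mul_pow (k : ℕ) {x : ℝ} (hx : x ∈ Set.Ioo (0 : ℝ) 1) :
    HasSum (fun m => ((m + k).choose k : ℝ) * x ^ m) (1 / (1 - x) ^ (k + 1)) :=
  hasSum_choose_mul_geometric_of_norm_lt_one k (by rw [Real.norm_of_nonneg hx.1.le]; exact hx.2)

theorem tendsto_tsum_choose_mul_pow (k : ℕ) :
    Tendsto (fun x : ℝ => ∑' m, ((m + k).choose k : ℝ) * x ^ m) (𝓝[<] 1) atTop := by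
  have hpow : Tendsto (fun x : ℝ => (1 - x) ^ (k + 1)) (𝓝[<] 1) (𝓝[>] 0) := by
    refine tendsto_nhdsWithin_iff.2 ⟨?_, ?_⟩
    · have hcont : Continuous fun x : ℝ => (1 - x) ^ (k + 1) := by fun_prop
      simpa using (hcont.tendsto 1).mono_left nhdsWithin_le_nhds
    · filter_upwards [self_mem_nhdsWithin] with x hx
      exact pow_pos (sub_pos.2 (Set.mem_Iio.1 hx)) _
  refine hpow.inv_tendsto_nhdsGT_zero.congr' ?_
  filter_upwards [Ioo_mem_nhdsLT (zero_lt_one' ℝ)] with x hx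
  rw [(hasSum_choose_mul_pow k hx).tsum_eq, one_div, Pi.inv_apply]

theorem summable_mul_pow_of_tendsto_div_choose
    (h : Tendsto (fun m => a m / ((m + k).choose k : ℝ)) atTop (𝓝 L)) {x : ℝ}
    (hx : x ∈ Set.Ioo (0 : ℝ) 1) : Summable fun m => a m * x ^ m := by
  have ha : a =O[atTop] fun m => ((m + k).choose k : ℝ) :=
    isBigO_of_div_tendsto_nhds (.of_forall fun m h0 =>
      absurd h0 (Nat.cast_ne_zero.2 (Nat.choose_pos (Nat.le_add_left k m)).ne')) L h
  exact summable_of_isBigO_nat (hasSum_choose_mul_pow k hx).summable (ha.mul (isBigO_refl _ _))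

theorem tendsto_pow_mul_tsum_of_tendsto_div_choose
    (h : Tendsto (fun m => a m / ((m + k).choose k : ℝ)) atTop (𝓝 L)) :
    Tendsto (fun x : ℝ => (1 - x) ^ (k + 1) * ∑' m, a m * x ^ m) (𝓝[<] 1) (𝓝 L) := by
  have hne (m : ℕ) : ((m + k).choose k : ℝ) ≠ 0 :=
    Nat.cast_ne_zero.2 (Nat.choose_pos (Nat.le_add_left k m)).ne'
  have hlittle : (fun m => a m - L * (m + k).choose k) =o[atTop]
      fun m => ((m + k).choose k : ℝ) := by
    refine isLittleO_of_tendsto (fun m h0 => absurd h0 (hne m)) ?_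
    simpa [sub_div, hne] using h.sub_const L
  have hdiff := (isLittleO_tsum_mul_pow (fun m => Nat.cast_nonneg _) hlittle
    (fun x hx => (hasSum_choose_mul_pow k hx).summable)
    (tendsto_tsum_choose_mul_pow k)).tendsto_div_nhds_zero.add_const L
  rw [zero_add] at hdiff
  refine hdiff.congr' ?_
  filter_upwards [Ioo_mem_nhdsLT (zero_lt_one' ℝ)] with x hx
  have hb := hasSum_choose_mul_pow k hx
  have htsum : ∑' m, (a m - L * (m + k).choose k) * x ^ m =
      ∑' m, a m * x ^ m - L * (1 / (1 - x) ^ (k + 1)) := by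
    simpa only [sub_mul, mul_assoc] using
      ((summable_mul_pow_of_tendsto_div_choose h hx).hasSum.sub (hb.mul_left L)).tsum_eq
  have hx1 : (1 - x) ^ (k + 1) ≠ 0 := (pow_pos (sub_pos.2 hx.2) _).ne'
  rw [htsum, hb.tsum_eq]
  field_simp
  ring

end Abel

section Degree

variable {R : Type*} [CommRing R] [IsDomain R] [Algebra ℂ R] {𝒜 : ℕ → Submodule ℂ R} {k : ℕ}
  {L : ℝ}

theorem hasDegree_of_tendsto (hfin : ∀ j, Module.Finite ℂ (𝒜 j))
    (htr : Algebra.trdeg ℂ R = (k + 1 : ℕ))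
    (h : Tendsto (fun j => (Module.finrank ℂ (𝒜 j) : ℝ) / ((j + k).choose k : ℝ)) atTop (𝓝 L)) :
    HasDegree 𝒜 L := by
  refine ⟨hfin, k + 1, (trdeg_fractionRing ℂ R).trans htr, ?_, ?_⟩ <;>
    simp only [poincareSeries, PowerSeries.coeff_mk]
  exacts [fun z => summable_mul_pow_of_tendsto_div_choose h,
    tendsto_pow_mul_tsum_of_tendsto_div_choose h]

theorem hasSum_even {a : ℕ → ℝ} {z : ℝ} (hodd : ∀ m, a (2 * m + 1) = 0)
    (hsum : Summable fun m => a (2 * m) * (z ^ 2) ^ m) :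
    HasSum (fun j => a j * z ^ j) (∑' m, a (2 * m) * (z ^ 2) ^ m) := by
  rw [← add_zero (∑' m, a (2 * m) * (z ^ 2) ^ m)]
  refine HasSum.even_add_odd ?_ ?_
  · simpa only [pow_mul] using hsum.hasSum
  · simpa only [hodd, zero_mul] using hasSum_zero

theorem tendsto_sq_nhdsLT_one : Tendsto (fun z : ℝ => z ^ 2) (𝓝[<] 1) (𝓝[<] 1) := by
  refine tendsto_nhdsWithin_iff.2 ⟨?_, ?_⟩
  · simpa using ((continuous_pow 2).tendsto (1 : ℝ)).mono_left nhdsWithin_le_nhds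
  · filter_upwards [Ioo_mem_nhdsLT (zero_lt_one' ℝ)] with z hz
    exact pow_lt_one₀ hz.1.le hz.2 two_ne_zero

theorem hasDegree_of_tendsto_even (hfin : ∀ j, Module.Finite ℂ (𝒜 j))
    (htr : Algebra.trdeg ℂ R = (k + 1 : ℕ)) (hodd : ∀ m, Module.finrank ℂ (𝒜 (2 * m + 1)) = 0)
    (h : Tendsto (fun m => (Module.finrank ℂ (𝒜 (2 * m)) : ℝ) / ((m + k).choose k : ℝ))
      atTop (𝓝 L)) : HasDegree 𝒜 (L / 2 ^ (k + 1)) := by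
  have hsum {z : ℝ} (hz : z ∈ Set.Ioo (0 : ℝ) 1) :=
    hasSum_even (a := fun j => (Module.finrank ℂ (𝒜 j) : ℝ)) (z := z)
      (fun m => Nat.cast_eq_zero.2 (hodd m)) (summable_mul_pow_of_tendsto_div_choose h
        ⟨pow_pos hz.1 2, pow_lt_one₀ hz.1.le hz.2 two_ne_zero⟩)
  refine ⟨hfin, k + 1, (trdeg_fractionRing ℂ R).trans htr, ?_, ?_⟩ <;>
    simp only [poincareSeries, PowerSeries.coeff_mk]
  · exact fun z hz => (hsum hz).summable
  have hden : Tendsto (fun z : ℝ => (1 + z) ^ (k + 1)) (𝓝[<] 1) (𝓝 (2 ^ (k + 1))) := by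
    have hcont : Continuous fun z : ℝ => (1 + z) ^ (k + 1) := by fun_prop
    simpa [one_add_one_eq_two] using (hcont.tendsto 1).mono_left nhdsWithin_le_nhds
  refine (((tendsto_pow_mul_tsum_of_tendsto_div_choose h).comp tendsto_sq_nhdsLT_one).div hden
    (by positivity)).congr' ?_
  filter_upwards [Ioo_mem_nhdsLT (zero_lt_one' ℝ)] with z hz
  have hz1 : (1 + z) ^ (k + 1) ≠ 0 := (pow_pos (by linarith [hz.1]) _).ne'
  rw [(hsum hz).tsum_eq, Pi.div_apply, Function.comp_apply,
    show 1 - z ^ 2 = (1 - z) * (1 + z) by ring, mul_pow]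
  field_simp

end Degree

section Binomial

theorem tendsto_choose_div_pow (k : ℕ) {u : ℕ → ℕ} {c : ℝ}
    (hu : Tendsto (fun j => (u j : ℝ) / j) atTop (𝓝 c)) :
    Tendsto (fun j => ((u j + k).choose k : ℝ) / (j : ℝ) ^ k) atTop
      (𝓝 (c ^ k / (k.factorial : ℝ))) := by
  have hfactor (i : ℕ) : Tendsto (fun j => ((u j : ℝ) + 1 + i) / j) atTop (𝓝 c) := by
    simpa [add_div] using (hu.add (tendsto_const_div_atTop_nhds_zero_nat 1)).add
      (tendsto_const_div_atTop_nhds_zero_nat (i : ℝ))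
  have hprod := (tendsto_finsetProd (Finset.range k) fun i _ => hfactor i).div_const
    (k.factorial : ℝ)
  rw [Finset.prod_const, Finset.card_range] at hprod
  refine hprod.congr fun j => ?_
  have hasc := congrArg (Nat.cast (R := ℝ)) (Nat.ascFactorial_eq_factorial_mul_choose (u j) k)
  rw [Nat.ascFactorial_eq_prod_range] at hasc
  push_cast at hasc
  rw [Finset.prod_div_distrib, Finset.prod_const, Finset.card_range, hasc]
  field_simp

theorem tendsto_natCast_self_div : Tendsto (fun j : ℕ => (j : ℝ) / j) atTop (𝓝 1) := by
  simpa using tendsto_natCast_div_add_atTop (0 : ℝ)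

theorem tendsto_choose_mul_choose_div (N : ℕ) {u v : ℕ → ℕ} {c : ℝ}
    (hu : Tendsto (fun j => (u j : ℝ) / j) atTop (𝓝 c))
    (hv : Tendsto (fun j => (v j : ℝ) / j) atTop (𝓝 c)) :
    Tendsto (fun j => ((u j + N).choose N * (v j + N).choose N : ℝ) / (j + 2 * N).choose (2 * N))
      atTop (𝓝 (N.centralBinom * (c ^ 2) ^ N)) := by
  have hlim := ((tendsto_choose_div_pow N hu).mul (tendsto_choose_div_pow N hv)).div
    (tendsto_choose_div_pow (2 * N) tendsto_natCast_self_div) (by positivity)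
  have hcentral : c ^ N / N.factorial * (c ^ N / N.factorial) / (1 ^ (2 * N) / (2 * N).factorial) =
      N.centralBinom * (c ^ 2) ^ N := by
    rw [Nat.centralBinom_eq_two_mul_choose, two_mul, Nat.cast_add_choose, one_pow,
      pow_right_comm]
    field_simp
  rw [hcentral] at hlim
  refine hlim.congr' ?_
  filter_upwards [eventually_gt_atTop 0] with j hj
  simp only [Pi.div_apply]
  field_simp
  ring

theorem tendsto_natCast_half_div :
    Tendsto (fun j : ℕ => ((j / 2 : ℕ) : ℝ) / j) atTop (𝓝 (1 / 2)) := by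
  refine ((tendsto_nat_floor_mul_div_atTop (one_half_pos (α := ℝ)).le).comp
    tendsto_natCast_atTop_atTop).congr fun j => ?_
  have h := Nat.floor_div_eq_div (K := ℝ) j 2
  rw [Nat.cast_ofNat] at h
  rw [Function.comp_apply, one_div_mul_eq_div, h]

theorem tendsto_natCast_succ_div :
    Tendsto (fun j : ℕ => ((j + 1 : ℕ) : ℝ) / j) atTop (𝓝 1) := by
  simpa using (tendsto_natCast_div_add_atTop (1 : ℝ)).inv₀ one_ne_zero

theorem tendsto_natCast_succ_half_div :
    Tendsto (fun j : ℕ => (((j + 1) / 2 : ℕ) : ℝ) / j) atTop (𝓝 (1 / 2)) := by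
  have h := ((tendsto_add_atTop_iff_nat 1).2 tendsto_natCast_half_div).mul tendsto_natCast_succ_div
  rw [mul_one] at h
  refine h.congr fun j => ?_
  rw [div_mul_div_cancel₀ (Nat.cast_ne_zero.2 j.succ_ne_zero)]

theorem multichoose_succ_eq_choose (N m : ℕ) : (N + 1).multichoose m = (m + N).choose N := by
  rw [Nat.multichoose_eq, show N + 1 + m - 1 = m + N by omega, Nat.choose_symm_add]

theorem multichoose_sq_sub_multichoose_mul (N m : ℕ) :
    ((N + 2).multichoose (m + 1) : ℝ) * (N + 2).multichoose (m + 1) -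
      (N + 2).multichoose (m + 2) * (N + 2).multichoose m =
      (m + 1 + N).choose N * (m + 2 + N).choose N / (N + 1) := by
  have hchoose (m N : ℕ) : ((m + N).choose N : ℝ) =
      (m + N).factorial / (m.factorial * N.factorial) := by
    rw [add_comm m N, Nat.cast_add_choose, mul_comm]
  simp only [multichoose_succ_eq_choose, hchoose]
  simp only [show m + 1 + (N + 1) = m + N + 2 by ring, show m + 2 + (N + 1) = m + N + 3 by ring,
    show m + (N + 1) = m + N + 1 by ring, show m + 1 + N = m + N + 1 by ring,
    show m + 2 + N = m + N + 2 by ring, Nat.factorial_succ]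
  push_cast
  field_simp
  ring

end Binomial

section Stirling

theorem centralBinom_div_four_pow {N : ℕ} (hN : N ≠ 0) :
    (N.centralBinom : ℝ) / 4 ^ N =
      Stirling.stirlingSeq (2 * N) / Stirling.stirlingSeq N ^ 2 * (1 / √N) := by
  have hN' : (0 : ℝ) < N := Nat.cast_pos.2 (Nat.pos_of_ne_zero hN)
  have hsqrt : √(2 * ((2 * N : ℕ) : ℝ)) = 2 * √N := by
    rw [Nat.cast_mul, Nat.cast_ofNat, ← mul_assoc, Real.sqrt_mul (by norm_num),
      Real.sqrt_mul_self zero_le_two]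
  have hpow : (((2 * N : ℕ) : ℝ) / Real.exp 1) ^ (2 * N) =
      4 ^ N * (((N : ℝ) / Real.exp 1) ^ N) ^ 2 := by
    rw [Nat.cast_mul, Nat.cast_ofNat, mul_div_assoc, mul_pow, pow_mul, ← pow_mul _ N, mul_comm N]
    norm_num
  have hsq : √(2 * (N : ℝ)) ^ 2 = 2 * √N ^ 2 := by
    rw [Real.sq_sqrt (by positivity), Real.sq_sqrt hN'.le]
  rw [Stirling.stirlingSeq, Stirling.stirlingSeq, Nat.centralBinom_eq_two_mul_choose, two_mul,
    Nat.cast_add_choose, ← two_mul, hsqrt, hpow, div_pow _ (√(2 * (N : ℝ)) * _),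
    mul_pow (√(2 * (N : ℝ))), hsq]
  field_simp

theorem centralBinom_div_isEquivalent :
    (fun N : ℕ => (N.centralBinom : ℝ) / 4 ^ N) ~[atTop] fun N => 1 / √(Real.pi * N) := by
  have hratio : Tendsto (fun N => Stirling.stirlingSeq (2 * N) / Stirling.stirlingSeq N ^ 2) atTop
      (𝓝 (1 / √Real.pi)) := by
    have hpi : √Real.pi / √Real.pi ^ 2 = 1 / √Real.pi := by field_simp
    rw [← hpi]
    exact (Stirling.tendsto_stirlingSeq_sqrt_pi.comp
      (tendsto_id.const_mul_atTop' two_pos)).div (Stirling.tendsto_stirlingSeq_sqrt_pi.pow 2)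
      (by positivity)
  have h := ((isEquivalent_const_iff_tendsto (by positivity)).2 hratio).mul
    (IsEquivalent.refl (u := fun N : ℕ => 1 / √(N : ℝ)))
  refine (h.congr_left ?_).congr_right (.of_forall fun N => ?_)
  · filter_upwards [eventually_ne_atTop 0] with N hN
    exact (centralBinom_div_four_pow hN).symm
  · simp [Real.sqrt_mul Real.pi_nonneg, mul_comm]

theorem isEquivalent_atTop_iff_add (k : ℕ) {u v : ℕ → ℝ} :
    (fun n => u (n + k)) ~[atTop] (fun n => v (n + k)) ↔ u ~[atTop] v := by
  conv_rhs => rw [← map_add_atTop_eq_nat k]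
  exact isEquivalent_map.symm

theorem natCast_isEquivalent_add (a : ℕ) :
    (fun N : ℕ => (N : ℝ)) ~[atTop] fun N => ((N + a : ℕ) : ℝ) :=
  isEquivalent_of_tendsto_one (by
    simpa [Pi.div_def] using tendsto_natCast_div_add_atTop (a : ℝ))

theorem one_div_sqrt_pi_mul_pow_isEquivalent_add (a k : ℕ) :
    (fun N : ℕ => 1 / √(Real.pi * (N : ℝ) ^ k)) ~[atTop]
      fun N => 1 / √(Real.pi * ((N + a : ℕ) : ℝ) ^ k) := by
  have hmul := (IsEquivalent.refl (u := fun _ : ℕ => Real.pi)).mul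
    ((natCast_isEquivalent_add a).pow k)
  have hnonneg : 0 ≤ (fun _ : ℕ => Real.pi) * (fun N : ℕ => ((N + a : ℕ) : ℝ)) ^ k :=
    fun N => mul_nonneg Real.pi_nonneg (pow_nonneg (Nat.cast_nonneg _) k)
  simpa only [one_div, Real.sqrt_eq_rpow] using! (hmul.rpow (r := 1 / 2) hnonneg).inv

theorem centralBinom_pred_div_isEquivalent :
    (fun n : ℕ => ((n - 1).centralBinom : ℝ) / 4 ^ (n - 1)) ~[atTop]
      fun n => 1 / √(Real.pi * n) := by
  have h := centralBinom_div_isEquivalent.trans (by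
    simpa only [pow_one] using one_div_sqrt_pi_mul_pow_isEquivalent_add 1 1)
  exact (isEquivalent_atTop_iff_add 1).1 (by simpa only [Nat.add_sub_cancel] using h)

theorem catalan_div_isEquivalent :
    (fun N : ℕ => (catalan N : ℝ) / 2 ^ (2 * N + 1)) ~[atTop]
      fun N => 1 / (2 * √(Real.pi * (N : ℝ) ^ 3)) := by
  have h := (centralBinom_div_isEquivalent.div (natCast_isEquivalent_add 1).symm).mul
    (IsEquivalent.refl (u := fun _ : ℕ => (1 / 2 : ℝ)))
  refine (h.congr_left (.of_forall fun N => ?_)).congr_right (.of_forall fun N => ?_)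
  · simp only [Pi.mul_apply, Pi.div_apply]
    rw [← succ_mul_catalan_eq_centralBinom, pow_succ, pow_mul]
    norm_num
    field_simp
  · simp only [Pi.mul_apply, Pi.div_apply]
    rw [show Real.pi * (N : ℝ) ^ 3 = N ^ 2 * (Real.pi * N) by ring, Real.sqrt_mul (sq_nonneg _),
      Real.sqrt_sq N.cast_nonneg]
    field_simp

theorem catalan_sub_two_div_isEquivalent :
    (fun n : ℕ => (catalan (n - 2) : ℝ) / 2 ^ (2 * n - 3)) ~[atTop]
      fun n => 1 / (2 * √(Real.pi * (n : ℝ) ^ 3)) := by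
  have hshift := (IsEquivalent.refl (u := fun _ : ℕ => (1 / 2 : ℝ))).mul
    (one_div_sqrt_pi_mul_pow_isEquivalent_add 2 3)
  have h := catalan_div_isEquivalent.trans (by
    simpa only [Pi.mul_def, one_div_mul_one_div] using hshift)
  exact (isEquivalent_atTop_iff_add 2).1 (by
    simpa only [Nat.add_sub_cancel, show ∀ N, 2 * (N + 2) - 3 = 2 * N + 1 by omega] using h)

end Stirling

section Degrees

theorem hasDegree_covariantsGrading (N : ℕ) :
    HasDegree (covariantsGrading (N + 1)) (N.centralBinom / 4 ^ N) := by
  have hlim := tendsto_choose_mul_choose_div N tendsto_natCast_half_div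
    tendsto_natCast_succ_half_div
  have hquarter : (N.centralBinom : ℝ) * ((1 / 2) ^ 2) ^ N = N.centralBinom / 4 ^ N := by
    rw [show (1 / 2 : ℝ) ^ 2 = 4⁻¹ by norm_num, inv_pow, div_eq_mul_inv]
  rw [hquarter] at hlim
  refine hasDegree_of_tendsto (finite_covariantsGrading _) (trdeg_jointCovariants N)
    (hlim.congr fun j => ?_)
  rw [finrank_covariantsGrading, multichoose_succ_eq_choose, multichoose_succ_eq_choose,
    Nat.cast_mul]

theorem hasDegree_invariantsGrading (N : ℕ) :
    HasDegree (invariantsGrading (N + 2)) (catalan N / 2 ^ (2 * N + 1)) := by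
  have hlim := (tendsto_choose_mul_choose_div N tendsto_natCast_self_div
    tendsto_natCast_succ_div).div_const (N + 1 : ℝ)
  have hcatalan : (N.centralBinom : ℝ) * (1 ^ 2) ^ N / (N + 1) = catalan N := by
    rw [← succ_mul_catalan_eq_centralBinom]
    push_cast
    field_simp
    ring
  rw [hcatalan] at hlim
  refine hasDegree_of_tendsto_even (finite_invariantsGrading _) (trdeg_jointInvariants N)
    (fun m => ?_) (hlim.congr' ?_)
  · rw [finrank_invariantsGrading, finrank_multidegInvariants_odd]
  · filter_upwards [eventually_ne_atTop 0] with m hm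
    obtain ⟨m, rfl⟩ := Nat.exists_eq_succ_of_ne_zero hm
    have hdim := congrArg (Nat.cast (R := ℝ))
      (finrank_multidegInvariants_even (σ := Fin (N + 2)) ℂ m)
    rw [Fintype.card_fin, Nat.cast_add, Nat.cast_mul, Nat.cast_mul] at hdim
    rw [finrank_invariantsGrading, Nat.succ_eq_add_one, eq_sub_of_add_eq hdim,
      multichoose_sq_sub_multichoose_mul]
    ring

theorem finrank_invariantsGrading_one (j : ℕ) :
    Module.finrank ℂ (invariantsGrading 1 j) = if j = 0 then 1 else 0 := by
  rw [finrank_invariantsGrading]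
  rcases Nat.even_or_odd' j with ⟨_ | m, rfl | rfl⟩
  · exact finrank_multidegInvariants_zero ℂ
  · rw [finrank_multidegInvariants_odd, if_neg (by omega)]
  · have h := finrank_multidegInvariants_even (σ := Fin 1) ℂ m
    simp only [Fintype.card_fin, Nat.multichoose_one] at h
    rw [if_neg (by omega)]
    omega
  · rw [finrank_multidegInvariants_odd, if_neg (by omega)]

theorem hasDegree_invariantsGrading_one : HasDegree (invariantsGrading 1) 1 := by
  have hsum (z : ℝ) :
      HasSum (fun j => (poincareSeries (invariantsGrading 1)).coeff j * z ^ j) 1 := by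
    have hcoeff (j : ℕ) : (poincareSeries (invariantsGrading 1)).coeff j * z ^ j =
        if j = 0 then 1 else 0 := by
      rw [poincareSeries, PowerSeries.coeff_mk, finrank_invariantsGrading_one]
      split_ifs with hj <;> simp [hj]
    simpa only [hcoeff] using hasSum_ite_eq 0 (1 : ℝ)
  refine ⟨finite_invariantsGrading 1, 0, ?_, fun z _ => (hsum z).summable, ?_⟩
  · rw [trdeg_fractionRing, trdeg_jointInvariants_one, Nat.cast_zero]
  · simp only [pow_zero, one_mul, (hsum _).tsum_eq]
    exact tendsto_const_nhds

end Degrees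

end LinearForms

theorem mainTheorem4 :
    ∃ degI degC : ℕ → ℝ,
      (∀ n : ℕ, 1 ≤ n → LinearForms.HasDegree (LinearForms.invariantsGrading n) (degI n)) ∧
      (∀ n : ℕ, 1 ≤ n → LinearForms.HasDegree (LinearForms.covariantsGrading n) (degC n)) ∧
      Asymptotics.IsEquivalent Filter.atTop degI
        (fun n : ℕ => 1 / (2 * Real.sqrt (Real.pi * (n : ℝ) ^ 3))) ∧
      Asymptotics.IsEquivalent Filter.atTop degC
        (fun n : ℕ => 1 / Real.sqrt (Real.pi * (n : ℝ))) := by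
  refine ⟨fun n => catalan (n - 2) / 2 ^ (2 * n - 3), fun n => (n - 1).centralBinom / 4 ^ (n - 1),
    fun n hn => ?_, fun n hn => ?_, LinearForms.catalan_sub_two_div_isEquivalent,
    LinearForms.centralBinom_pred_div_isEquivalent⟩
  · obtain rfl | ⟨N, rfl⟩ : n = 1 ∨ ∃ N, n = N + 2 := by
      rcases n with _ | _ | N
      exacts [absurd hn (by norm_num), .inl rfl, .inr ⟨N, rfl⟩]
    · -- Truncated subtraction makes the formula for `n ≥ 2` correct at `n = 1` too.
      simpa using LinearForms.hasDegree_invariantsGrading_one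
    · exact LinearForms.hasDegree_invariantsGrading N
  · obtain ⟨N, rfl⟩ := Nat.exists_eq_add_of_le' hn
    exact LinearForms.hasDegree_covariantsGrading N
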